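/- Let $0<k<d$ and let $f\in R=\mathbb{C}[x_0,\dots,x_n]$ be a homogeneous polynomial of degree $d$ such that $X=V(f)\subset\mathbb{P}^n$ is not a cone, i.e. no invertible linear change of coordinates turns $f$ into a polynomial in $x_1,\dots,x_n$ only. Let $Q=\mathbb{C}[X_0,\dots,X_n]$ act on $R$ by $X_i=\partial/\partial x_i$, let $\operatorname{Ann}(f)=\{\alpha\in Q:\alpha(f)=0\}$, and let $A=Q/\operatorname{Ann}(f)=\bigoplus_i A_i$ be graded by degree. Choose bases $(\alpha_1,\dots,\alpha_{n+1})$ of $A_1$ and $(\beta_1,\dots,\beta_{a_k})$ of $A_k$, and let $\operatorname{Hess}^{(1,k)}_f=[\alpha_i\beta_j(f)]$ be the mixed Hessian, a matrix of polynomials whose rank is taken over the field $\mathbb{C}(x_0,\dots,x_n)$. Let $\tilde Z_k\subseteq\mathbb{P}^{\binom{n+k}{k}-1}$ be the Zariski closure of the image of the $k$-th polar map $\Phi^k:\mathbb{P}^n\dashrightarrow\mathbb{P}^{\binom{n+k}{k}-1}$ given by all $k$-th order partial derivatives of $f$, and let $Z_k\subseteq\mathbb{P}^{a_k-1}$ be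 the Zariski closure of the image of the relative $k$-th polar map $\varphi^k:\mathbb{P}^n\dashrightarrow\mathbb{P}^{a_k-1}$, $p\mapsto(\beta_1(f)(p):\dots:\beta_{a_k}(f)(p))$. Then $$\dim Z_k=\dim\tilde Z_k=\operatorname{rank}\bigl(\operatorname{Hess}^{(1,k)}_f\bigr)-1 .$$ Moreover, the following conditions are equivalent: (i) $\varphi^k$ is degenerate, that is, $\dim Z_k<n$; (ii) $\operatorname{rank}\bigl(\operatorname{Hess}^{(1,k)}_f\bigr)<n+1$; (iii) for no $L\in A_1$ does the multiplication map $\bullet L^{d-k-1}:A_1\to A_{d-k}$ have maximal rank, i.e. rank equal to $\min(\dim A_1,\dim A_{d-k})$. -/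

import Mathlib

open MvPolynomial

namespace HigherPolar

noncomputable section

/-! ### Macaulay–Matlis duality: polynomials as differential operators -/

/-- The partial derivative `∂/∂x_i` as a `ℂ`-linear endomorphism of `ℂ[x_σ]`. -/
def partialEnd {σ : Type*} (i : σ) : Module.End ℂ (MvPolynomial σ ℂ) :=
  (pderiv i : Derivation ℂ (MvPolynomial σ ℂ) (MvPolynomial σ ℂ)).toLinearMap

theorem partialEnd_apply {σ : Type*} (i : σ) (g : MvPolynomial σ ℂ) :
    partialEnd i g = pderiv i g := rfl

theorem partialEnd_comm {σ : Type*} (i j : σ) :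
    (partialEnd i : Module.End ℂ (MvPolynomial σ ℂ)) * partialEnd j
      = partialEnd j * partialEnd i := by
  classical
  have h : ⁅(pderiv i : Derivation ℂ (MvPolynomial σ ℂ) (MvPolynomial σ ℂ)),
      (pderiv j : Derivation ℂ (MvPolynomial σ ℂ) (MvPolynomial σ ℂ))⁆ = 0 := by
    apply derivation_ext
    intro l
    by_cases h1 : l = i <;> by_cases h2 : l = j <;>
      simp [Derivation.commutator_apply, pderiv_X, Pi.single_apply, h1, h2] <;>
      split_ifs <;> simp
  refine LinearMap.ext fun g => ?_
  have hg := congrArg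
    (fun D : Derivation ℂ (MvPolynomial σ ℂ) (MvPolynomial σ ℂ) => D g) h
  simp only [Derivation.commutator_apply, Derivation.coe_zero, Pi.zero_apply] at hg
  exact sub_eq_zero.mp hg

/-- The (commutative) algebra of differential operators with constant coefficients. -/
abbrev DiffOps (σ : Type*) : Subalgebra ℂ (Module.End ℂ (MvPolynomial σ ℂ)) :=
  Algebra.adjoin ℂ (Set.range partialEnd)

instance instCommRingDiffOps (σ : Type*) : CommRing (DiffOps σ) :=
  { (inferInstance : Ring (DiffOps σ)) with
    mul_comm := by
      have := Algebra.isMulCommutative_adjoin ℂ (s := Set.range (partialEnd (σ := σ))) (by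
        rintro _ ⟨i, rfl⟩ _ ⟨j, rfl⟩
        exact partialEnd_comm i j)
      exact this.is_comm.comm }

/-- The action of `Q = ℂ[X_σ]` on `R = ℂ[x_σ]` by differential operators: the algebra
homomorphism with `X i ↦ ∂/∂x_i`. -/
def diffOp {σ : Type*} : MvPolynomial σ ℂ →ₐ[ℂ] Module.End ℂ (MvPolynomial σ ℂ) :=
  (DiffOps σ).val.comp
    (aeval fun i => (⟨partialEnd i, Algebra.subset_adjoin ⟨i, rfl⟩⟩ : DiffOps σ))

theorem diffOp_X {σ : Type*} (i : σ) (g : MvPolynomial σ ℂ) :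
    diffOp (X i) g = pderiv i g := by
  simp [diffOp, partialEnd_apply]

/-- The annihilator ideal `Ann(f) = {α ∈ Q | α(f) = 0}`. -/
def Ann {σ : Type*} (f : MvPolynomial σ ℂ) : Ideal (MvPolynomial σ ℂ) where
  carrier := {α | diffOp α f = 0}
  add_mem' := by
    intro a b ha hb
    simp only [Set.mem_ofPred_eq] at ha hb ⊢
    simp [ha, hb]
  zero_mem' := by simp
  smul_mem' := by
    intro c a ha
    simp only [Set.mem_ofPred_eq] at ha ⊢
    simp [ha]

theorem mem_Ann {σ : Type*} (f α : MvPolynomial σ ℂ) : α ∈ Ann f ↔ diffOp α f = 0 := Iff.rfl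

/-- The algebra `A(f) = Q / Ann(f)`. -/
abbrev A {σ : Type*} (f : MvPolynomial σ ℂ) : Type _ := MvPolynomial σ ℂ ⧸ Ann f

/-- The graded piece `A(f)_k`, the image of `Q_k` in `A(f)`. -/
def gradedPiece {σ : Type*} (f : MvPolynomial σ ℂ) (k : ℕ) : Submodule ℂ (A f) :=
  (homogeneousSubmodule σ ℂ k).map (Ideal.Quotient.mkₐ ℂ (Ann f)).toLinearMap

/-- For a class `a ∈ A(f)` represented by `α ∈ Q`, the polynomial `α(f)`. -/
def act {σ : Type*} (f : MvPolynomial σ ℂ) : A f →ₗ[ℂ] MvPolynomial σ ℂ :=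
  ((Ann f).restrictScalars ℂ).liftQ (diffOp.toLinearMap.flip f) (fun _ hα => hα) ∘ₗ
    (Submodule.Quotient.restrictScalarsEquiv ℂ (Ann f)).symm.toLinearMap

theorem act_mk {σ : Type*} (f α : MvPolynomial σ ℂ) :
    act f (Ideal.Quotient.mk (Ann f) α) = diffOp α f := rfl

/-- The mixed Hessian `Hess_f^{(k,l)} = [α_i β_j (f)]` with respect to bases `(α_i)` of `A(f)_k`
and `(β_j)` of `A(f)_l`; its entries are polynomials. -/
def mixedHessian {σ ι κ : Type*} (f : MvPolynomial σ ℂ) {k l : ℕ}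
    (a : Module.Basis ι ℂ (gradedPiece f k)) (b : Module.Basis κ ℂ (gradedPiece f l)) :
    Matrix ι κ (MvPolynomial σ ℂ) :=
  Matrix.of fun i j => act f ((a i : A f) * (b j : A f))

/-- The rank of a matrix of polynomials, i.e. its rank over the field of rational functions. -/
def genericRank {σ ι κ : Type*} [Fintype κ] (M : Matrix ι κ (MvPolynomial σ ℂ)) : ℕ :=
  (M.map (algebraMap (MvPolynomial σ ℂ) (FractionRing (MvPolynomial σ ℂ)))).rank

/-! ### Multiplication by powers of linear forms -/

theorem pow_mul_mem_gradedPiece {σ : Type*} (f : MvPolynomial σ ℂ) {i j : ℕ} (h : i ≤ j)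
    {L x : A f} (hL : L ∈ gradedPiece f 1) (hx : x ∈ gradedPiece f i) :
    L ^ (j - i) * x ∈ gradedPiece f j := by
  obtain ⟨l, hl, rfl⟩ := hL
  obtain ⟨y, hy, rfl⟩ := hx
  refine ⟨l ^ (j - i) * y, ?_, by simp⟩
  have h1 : (l ^ (j - i) * y).IsHomogeneous (1 * (j - i) + i) :=
    IsHomogeneous.mul (IsHomogeneous.pow hl _) hy
  rwa [one_mul, Nat.sub_add_cancel h] at h1

/-- The multiplication map `•L^{j-i} : A(f)_i → A(f)_j` for `L ∈ A(f)_1` and `i ≤ j`. -/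
def mulPow {σ : Type*} (f : MvPolynomial σ ℂ) {i j : ℕ} (h : i ≤ j) (L : gradedPiece f 1) :
    gradedPiece f i →ₗ[ℂ] gradedPiece f j :=
  (LinearMap.mulLeft ℂ ((L : A f) ^ (j - i))).restrict
    fun _ hx => pow_mul_mem_gradedPiece f h L.2 hx

/-- A linear map of finite-dimensional spaces has maximal rank if its rank is the minimum
of the dimensions of source and target. -/
def HasMaximalRank {V W : Type*} [AddCommGroup V] [Module ℂ V] [AddCommGroup W] [Module ℂ W]
    (g : V →ₗ[ℂ] W) : Prop :=
  Module.finrank ℂ (LinearMap.range g) = min (Module.finrank ℂ V) (Module.finrank ℂ W)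

/-! ### Projective space with its Zariski topology -/

/-- The projective space of lines in `ℂ^ι`, with homogeneous coordinates indexed by `ι`. -/
abbrev Proj (ι : Type*) : Type _ := Projectivization ℂ (ι → ℂ)

/-- The common zeros in projective space of a set of (homogeneous) polynomials. -/
def zeroLocus {ι : Type*} (S : Set (MvPolynomial ι ℂ)) : Set (Proj ι) :=
  {p | ∀ F ∈ S, eval p.rep F = 0}

theorem eval_smul {ι : Type*} {F : MvPolynomial ι ℂ} {m : ℕ} (hF : F.IsHomogeneous m)
    (c : ℂ) (v : ι → ℂ) : eval (c • v) F = c ^ m * eval v F := by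
  simp only [eval_eq, Finset.mul_sum]
  refine Finset.sum_congr rfl fun s hs => ?_
  have hd : ∑ i ∈ s.support, s i = m := by
    have := hF (mem_support_iff.mp hs)
    rw [Finsupp.weight_apply, Finsupp.sum] at this
    simpa using this
  simp only [Pi.smul_apply, smul_eq_mul, mul_pow, Finset.prod_mul_distrib,
    Finset.prod_pow_eq_pow_sum, hd]
  ring

/-- Vanishing of a homogeneous polynomial may be tested on any homogeneous coordinates. -/
theorem mk_mem_zeroLocus {ι : Type*} {S : Set (MvPolynomial ι ℂ)}
    (hS : ∀ F ∈ S, ∃ m, F.IsHomogeneous m) (v : ι → ℂ) (hv : v ≠ 0) :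
    Projectivization.mk ℂ v hv ∈ zeroLocus S ↔ ∀ F ∈ S, eval v F = 0 := by
  obtain ⟨a, ha⟩ := Projectivization.exists_smul_eq_mk_rep ℂ v hv
  refine forall₂_congr fun F hF => ?_
  obtain ⟨m, hm⟩ := hS F hF
  rw [← ha, Units.smul_def, eval_smul hm]
  simp

/-- The Zariski topology on projective space: the closed sets are the zero loci of sets of
homogeneous polynomials. -/
instance zariskiTopology (ι : Type*) : TopologicalSpace (Proj ι) :=
  TopologicalSpace.ofClosed
    {Z | ∃ S : Set (MvPolynomial ι ℂ), (∀ F ∈ S, ∃ m, F.IsHomogeneous m) ∧ Z = zeroLocus S}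
    ⟨{1}, by
      rintro F rfl
      exact ⟨0, isHomogeneous_one _ _⟩, by
      ext p
      simp [zeroLocus]⟩
    (by
      intro T hT
      have hT' : ∀ Z : Set (Proj ι), ∃ S : Set (MvPolynomial ι ℂ), Z ∈ T →
          (∀ F ∈ S, ∃ m, F.IsHomogeneous m) ∧ Z = zeroLocus S := by
        intro Z
        by_cases h : Z ∈ T
        · obtain ⟨S, hS⟩ := hT h
          exact ⟨S, fun _ => hS⟩
        · exact ⟨∅, fun h' => absurd h' h⟩
      choose S hSZ using hT'
      have hS := fun Z hZT => (hSZ Z hZT).1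
      have hZ := fun Z hZT => (hSZ Z hZT).2
      refine ⟨⋃ Z ∈ T, S Z, ?_, ?_⟩
      · intro F hF
        simp only [Set.mem_iUnion] at hF
        obtain ⟨Z, hZT, hF⟩ := hF
        exact hS Z hZT F hF
      · ext p
        simp only [Set.mem_sInter, zeroLocus, Set.mem_iUnion, Set.mem_ofPred_eq]
        constructor
        · rintro h F ⟨Z, hZT, hF⟩
          have := h Z hZT
          rw [hZ Z hZT] at this
          exact this F hF
        · intro h Z hZT
          rw [hZ Z hZT]
          exact fun F hF => h F ⟨Z, hZT, hF⟩)
    (by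
      rintro _ ⟨S, hS, rfl⟩ _ ⟨T, hT, rfl⟩
      refine ⟨{H | ∃ F ∈ S, ∃ G ∈ T, H = F * G}, ?_, ?_⟩
      · rintro _ ⟨F, hF, G, hG, rfl⟩
        obtain ⟨a, ha⟩ := hS F hF
        obtain ⟨b, hb⟩ := hT G hG
        exact ⟨a + b, ha.mul hb⟩
      · ext p
        simp only [zeroLocus, Set.mem_union, Set.mem_ofPred_eq]
        constructor
        · rintro (h | h) _ ⟨F, hF, G, hG, rfl⟩
          · simp [h F hF]
          · simp [h G hG]
        · intro h
          by_contra! hc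
          obtain ⟨⟨F, hF, hF0⟩, G, hG, hG0⟩ := hc
          have := h _ ⟨F, hF, G, hG, rfl⟩
          simp [hF0, hG0] at this)

theorem isClosed_iff {ι : Type*} (Z : Set (Proj ι)) :
    IsClosed Z ↔
      ∃ S : Set (MvPolynomial ι ℂ), (∀ F ∈ S, ∃ m, F.IsHomogeneous m) ∧ Z = zeroLocus S := by
  rw [← isOpen_compl_iff]
  change Zᶜᶜ ∈ _ ↔ _
  rw [compl_compl]
  rfl

/-! ### Rational maps and polar images -/

/-- The rational map of projective spaces `p ↦ (F_j(p))_j` given by a family of polynomials,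
as a partial function, defined where the `F_j` do not all vanish. It is meant for families of
homogeneous polynomials of one common degree. -/
def ratMap {σ ι : Type*} (F : ι → MvPolynomial σ ℂ) : Proj σ →. Proj ι :=
  fun p => ⟨(fun j => eval p.rep (F j)) ≠ 0, fun h => Projectivization.mk ℂ _ h⟩

/-- For forms of one common degree the rational map may be computed in any homogeneous
coordinates of the point. -/
theorem mem_ratMap_mk {σ ι : Type*} {F : ι → MvPolynomial σ ℂ} {m : ℕ}
    (hF : ∀ j, (F j).IsHomogeneous m) (v : σ → ℂ) (hv : v ≠ 0) (q : Proj ι) :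
    q ∈ ratMap F (Projectivization.mk ℂ v hv) ↔
      ∃ h : (fun j => eval v (F j)) ≠ 0, q = Projectivization.mk ℂ _ h := by
  obtain ⟨a, ha⟩ := Projectivization.exists_smul_eq_mk_rep ℂ v hv
  have key : (fun j => eval (Projectivization.mk ℂ v hv).rep (F j))
      = (a ^ m) • fun j => eval v (F j) := by
    funext j
    rw [← ha, Units.smul_def, eval_smul (hF j)]
    simp [Units.smul_def]
  have hne : (fun j => eval (Projectivization.mk ℂ v hv).rep (F j)) ≠ 0 ↔
      (fun j => eval v (F j)) ≠ 0 := by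
    rw [key, ne_eq, smul_eq_zero_iff_eq]
  constructor
  · rintro ⟨h, rfl⟩
    refine ⟨hne.mp h, ?_⟩
    exact (Projectivization.mk_eq_mk_iff ℂ _ _ _ _).mpr ⟨a ^ m, key.symm⟩
  · rintro ⟨h, rfl⟩
    refine ⟨hne.mpr h, ?_⟩
    exact (Projectivization.mk_eq_mk_iff ℂ _ _ _ _).mpr ⟨a ^ m, key.symm⟩

/-- The `k`-th polar map `Φ^k`, given by all the `k`-th order partial derivatives of `f`. They are
indexed by the unordered `k`-tuples of variables; there are `(n+k).choose k` of them if there are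
`n+1` variables. -/
def polarMap {σ : Type*} (f : MvPolynomial σ ℂ) (k : ℕ) : Proj σ →. Proj (Sym σ k) :=
  ratMap fun s => diffOp ((s : Multiset σ).map X).prod f

/-- The relative `k`-th polar map `φ^k = (α_1(f) : ⋯ : α_{a_k}(f))`, for a basis `(α_j)`
of `A(f)_k`. -/
def relPolarMap {σ κ : Type*} (f : MvPolynomial σ ℂ) {k : ℕ}
    (b : Module.Basis κ ℂ (gradedPiece f k)) : Proj σ →. Proj κ :=
  ratMap fun j => act f (b j : A f)

/-- The `k`-th polar image `Z̃_k`, the Zariski closure of the image of `Φ^k`. -/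
def polarImage {σ : Type*} (f : MvPolynomial σ ℂ) (k : ℕ) : Set (Proj (Sym σ k)) :=
  closure (polarMap f k).ran

/-- The relative `k`-th polar image `Z_k`, the Zariski closure of the image of `φ^k`. -/
def relPolarImage {σ κ : Type*} (f : MvPolynomial σ ℂ) {k : ℕ}
    (b : Module.Basis κ ℂ (gradedPiece f k)) : Set (Proj κ) :=
  closure (relPolarMap f b).ran

/-- `V(f) ⊆ ℙ^n` is a cone: after an invertible linear change of coordinates, `f` does not
involve the variable `x_0`. -/
def IsCone {n : ℕ} (f : MvPolynomial (Fin (n + 1)) ℂ) : Prop :=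
  ∃ M : GL (Fin (n + 1)) ℂ,
    (0 : Fin (n + 1)) ∉ (bind₁ (fun i => ∑ j, C (M.1 i j) * X j) f).vars

end

end HigherPolar

namespace HigherPolar

/-! ### Derivations and algebraic elements -/

section Derivation

variable {k R M : Type*} [Field k] [CommRing R] [Algebra k R]
  [AddCommGroup M] [Module R M] [Module k M]

/-! Both polar maps are given by forms of the same degree d - k > 0, and the two families of forms
span the same space. The closure of the image of such a map F has coordinate ring ℂ[F_j], whose
transcendence degree is, in characteristic zero, the rank of the Jacobian of F
(`trdeg_adjoin_eq_jacRank`). The Krull dimension is one less (`topologicalKrullDim_closure_ran`).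
The upper bound holds because this transcendence degree drops strictly along chains of irreducible
closed sets (`coneDim_lt`) and never reaches 0 (`coneDim_pos`). For the lower bound, restricting F
to a flag of linear subspaces through a general point produces a chain of the required length.
Expressing the X_l through a basis of A_1, and conversely, identifies the rank of the Jacobian with
that of the mixed Hessian (`genericRank_mixedHessian`). This gives the dimension formula and (i) ⇔
(ii).

For (iii), let L be the class of the linear form with coefficient vector v. By Euler's formula
L^m(g) = m! g(v) for a form g of degree m, so β L^(d-k-1) α (f) = (d-k-1)! (αβ f)(v) for α of degree
1 and β of degree k. Apolarity is nondegenerate, so the kernel of multiplication by L^(d-k-1) on A_1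
is the left kernel of the Hessian evaluated at v (`mulPow_injective_iff`). Maximal rank amounts to
injectivity (`hasMaximalRank_mulPow_iff`), and dim A_1 = n + 1 because X is not a cone. Hence some L
has maximal rank iff the Hessian has rank n + 1 at some point, which by minors means generic rank n
+ 1. -/

theorem derivation_aeval (D : Derivation k R M) (S : Subalgebra k R) (hS : ∀ s ∈ S, D s = 0)
    (x : R) (p : Polynomial S) :
    D (Polynomial.aeval x p) = Polynomial.aeval x (Polynomial.derivative p) • D x := by
  induction p using Polynomial.induction_on' with
  | add p q hp hq => simp [hp, hq, add_smul]
  | monomial n a =>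
    have ha : D (algebraMap S R a) = 0 := hS _ a.2
    rw [Polynomial.aeval_monomial, Polynomial.derivative_monomial, Polynomial.aeval_monomial,
      Derivation.leibniz, ha, Derivation.leibniz_pow, smul_zero, add_zero, map_mul, map_natCast,
      ← Nat.cast_smul_eq_nsmul R, smul_smul, smul_smul]

/-- For a nonzero p of least degree with p(x) = 0, one gets 0 = D(p(x)) = p'(x) D x. In
characteristic zero p' is nonzero of smaller degree, so p'(x) ≠ 0 by minimality, and M has no
torsion. -/
theorem derivation_eq_zero_of_isAlgebraic [CharZero k] [IsDomain R]
    (hM : ∀ (r : R) (m : M), r • m = 0 → r = 0 ∨ m = 0)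
    (D : Derivation k R M) (S : Subalgebra k R) (hS : ∀ s ∈ S, D s = 0) {x : R}
    (hx : IsAlgebraic S x) : D x = 0 := by
  have : CharZero S := charZero_of_injective_algebraMap (algebraMap k S).injective
  obtain ⟨p, ⟨hp0, hpx⟩, hmin⟩ :=
    WellFounded.has_min (InvImage.wf Polynomial.natDegree Nat.lt_wfRel.wf)
      {p : Polynomial S | p ≠ 0 ∧ Polynomial.aeval x p = 0} hx
  have hdeg : p.natDegree ≠ 0 := by
    intro h
    rw [Polynomial.eq_C_of_natDegree_eq_zero h, Polynomial.aeval_C] at hpx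
    apply hp0
    rw [Polynomial.eq_C_of_natDegree_eq_zero h]
    rw [(map_eq_zero_iff _ Subtype.val_injective).mp hpx, Polynomial.C_0]
  have hp' : Polynomial.derivative p ≠ 0 := fun h =>
    hdeg (Polynomial.derivative_eq_zero.mp h)
  have hne : Polynomial.aeval x (Polynomial.derivative p) ≠ 0 := fun h =>
    hmin _ ⟨hp', h⟩ (Polynomial.natDegree_derivative_lt hdeg)
  have := derivation_aeval D S hS x p
  rw [hpx, map_zero] at this
  exact (hM _ _ this.symm).resolve_left hne

theorem derivation_eq_zero_on_adjoin (D : Derivation k R M) (s : Set R) (hs : ∀ x ∈ s, D x = 0) :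
    ∀ x ∈ Algebra.adjoin k s, D x = 0 := by
  intro x hx
  induction hx using Algebra.adjoin_induction with
  | mem x hx => exact hs x hx
  | algebraMap r => simp
  | add x y _ _ hx hy => simp [hx, hy]
  | mul x y _ _ hx hy => simp [hx, hy]

end Derivation

/-! ### Gradients and transcendence degree -/

noncomputable section

/-- The gradient of a polynomial, as a vector of rational functions. -/
def grad {σ : Type*} :
    Derivation ℂ (MvPolynomial σ ℂ) (σ → FractionRing (MvPolynomial σ ℂ)) := by
  classical
  exact mkDerivation ℂ fun l => Pi.single l 1

theorem grad_X {σ : Type*} [DecidableEq σ] (l : σ) :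
    grad (X l : MvPolynomial σ ℂ) = Pi.single l 1 := by
  rw [grad, mkDerivation_X]
  congr!

theorem grad_apply {σ : Type*} (g : MvPolynomial σ ℂ) (l : σ) :
    grad g l = algebraMap _ (FractionRing (MvPolynomial σ ℂ)) (pderiv l g) := by
  classical
  induction g using MvPolynomial.induction_on with
  | C a =>
    rw [← algebraMap_eq, Derivation.map_algebraMap, Derivation.map_algebraMap]; simp
  | add p q hp hq => simp [hp, hq]
  | mul_X p i hp =>
    rw [Derivation.leibniz, Derivation.leibniz, grad_X, Pi.add_apply, Pi.smul_apply, Pi.smul_apply,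
      hp, map_add, smul_eq_mul, smul_eq_mul, map_mul, map_mul, Algebra.smul_def, Algebra.smul_def,
      pderiv_X]
    by_cases h : l = i
    · subst h; simp
    · simp [h, Ne.symm h]

/-- The rank of the Jacobian matrix of a family of polynomials. -/
def jacRank {σ ι : Type*} (F : ι → MvPolynomial σ ℂ) : ℕ :=
  Module.finrank (FractionRing (MvPolynomial σ ℂ))
    (Submodule.span (FractionRing (MvPolynomial σ ℂ)) (Set.range fun j => grad (F j)))

section

variable {σ : Type}

local notation "K" => FractionRing (MvPolynomial σ ℂ)

/-- Modulo the span, the gradient is a derivation that kills s, hence everything algebraic over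
ℂ[s]. -/
theorem grad_mem_span_of_isAlgebraic (s : Set (MvPolynomial σ ℂ)) {x : MvPolynomial σ ℂ}
    (hx : IsAlgebraic (Algebra.adjoin ℂ s) x) :
    grad x ∈ Submodule.span K (grad '' s) := by
  set V := Submodule.span K (grad '' s)
  let q : (σ → K) →ₗ[MvPolynomial σ ℂ] ((σ → K) ⧸ V) := V.mkQ.restrictScalars _
  have h0 : ∀ g, (q.compDer grad) g = 0 ↔ grad g ∈ V := fun g =>
    Submodule.Quotient.mk_eq_zero V
  rw [← h0]
  refine derivation_eq_zero_of_isAlgebraic ?_ _ _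
    (derivation_eq_zero_on_adjoin _ s fun y hy => ?_) hx
  · intro r m hrm
    by_cases hr : r = 0
    · exact Or.inl hr
    · have hr' : algebraMap (MvPolynomial σ ℂ) K r ≠ 0 := by simpa using hr
      rw [← algebraMap_smul K] at hrm
      exact Or.inr (by rw [← inv_smul_smul₀ hr' m, hrm, smul_zero])
  · exact (h0 y).mpr (Submodule.subset_span ⟨y, hy, rfl⟩)

/-- Every variable is algebraic over ℂ[s], so the gradients of s span the whole space; since s has
as many elements as σ, they are independent. -/
theorem linearIndependent_grad_of_isTranscendenceBasis [Finite σ]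
    (s : Set (MvPolynomial σ ℂ))
    (hs : IsTranscendenceBasis ℂ ((↑) : s → MvPolynomial σ ℂ)) :
    LinearIndependent K fun x : s => grad (x : MvPolynomial σ ℂ) := by
  classical
  have := Fintype.ofFinite σ
  have hcard : Cardinal.mk s = Cardinal.mk σ := by
    rw [hs.cardinalMk_eq_trdeg, MvPolynomial.trdeg_of_isDomain]; simp
  have : Finite s := by
    rw [← Cardinal.lt_aleph0_iff_finite, hcard]
    exact Cardinal.lt_aleph0_of_finite σ
  have := Fintype.ofFinite s
  refine linearIndependent_of_top_le_span_of_card_eq_finrank ?_ ?_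
  · have hX : ∀ l : σ, (Pi.single l 1 : σ → K) ∈
        Submodule.span K (Set.range fun x : s => grad (x : MvPolynomial σ ℂ)) := by
      intro l
      rw [← grad_X]
      have := grad_mem_span_of_isAlgebraic s (x := X l) ?_
      · rwa [Set.image_eq_range] at this
      · have := hs.isAlgebraic
        rw [Subtype.range_coe] at this
        exact this.isAlgebraic _
    rw [← (Pi.basisFun K σ).span_eq, Submodule.span_le]
    rintro _ ⟨l, rfl⟩
    simpa using hX l
  · rw [Module.finrank_pi]
    simpa using hcard

/-- Jacobian criterion. A transcendence basis chosen among the F_j extends to one of the full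
polynomial ring, so its gradients are independent; the remaining F_j are algebraic over it and add
nothing to the span. -/
theorem trdeg_adjoin_eq_jacRank [Finite σ] {ι : Type*} (F : ι → MvPolynomial σ ℂ) :
    Algebra.trdeg ℂ (Algebra.adjoin ℂ (Set.range F)) = jacRank F := by
  set B := Algebra.adjoin ℂ (Set.range F) with hB
  have htop : Algebra.adjoin ℂ ((↑) ⁻¹' Set.range F : Set B) = ⊤ :=
    Algebra.adjoin_adjoin_coe_preimage
  have : Algebra.IsAlgebraic (Algebra.adjoin ℂ ((↑) ⁻¹' Set.range F : Set B)) B := by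
    rw [htop]
    exact ⟨fun b => isAlgebraic_algebraMap (⟨b, trivial⟩ : (⊤ : Subalgebra ℂ B))⟩
  have : FaithfulSMul ℂ B := (faithfulSMul_iff_algebraMap_injective ℂ B).mpr
    (algebraMap ℂ B).injective
  obtain ⟨u, huF, hu⟩ :=
    exists_isTranscendenceBasis_subset (R := ℂ) ((↑) ⁻¹' Set.range F : Set B)
  set s : Set (MvPolynomial σ ℂ) := (↑) '' u with hs
  have hsF : s ⊆ Set.range F := by
    rintro _ ⟨b, hb, rfl⟩
    exact huF hb
  have hind : AlgebraicIndepOn ℂ id s := by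
    have h1 := (hu.1.map' (f := B.val) Subtype.val_injective).coe_range
    have h2 : Set.range (B.val ∘ ((↑) : u → B)) = s := by
      ext x; simp [hs]
    rw [h2] at h1
    exact h1
  obtain ⟨t, hst, ht⟩ := exists_isTranscendenceBasis_superset hind
  have hLI : LinearIndependent K fun x : s => grad (x : MvPolynomial σ ℂ) :=
    (linearIndependent_grad_of_isTranscendenceBasis t ht).comp (Set.inclusion hst)
      (Set.inclusion_injective hst)
  have halg : ∀ j, IsAlgebraic (Algebra.adjoin ℂ s) (F j) := by
    intro j
    have h1 := hu.isAlgebraic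
    rw [Subtype.range_coe] at h1
    have hm : ∀ x : Algebra.adjoin ℂ u,
        (B.val.comp (Algebra.adjoin ℂ u).val) x ∈ Algebra.adjoin ℂ s := by
      intro x
      have h2 : (Algebra.adjoin ℂ u).map B.val = Algebra.adjoin ℂ s := by
        rw [AlgHom.map_adjoin]; rfl
      rw [← h2]
      exact ⟨x, x.2, rfl⟩
    let f := (B.val.comp (Algebra.adjoin ℂ u).val).codRestrict _ hm
    have hf : ∀ x, (f x : MvPolynomial σ ℂ) = ((x : B) : MvPolynomial σ ℂ) := fun _ => rfl
    refine (h1.isAlgebraic ⟨F j, Algebra.subset_adjoin ⟨j, rfl⟩⟩).ringHom_of_comp_eq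
      f B.val (fun a b h => Subtype.ext (Subtype.ext ?_)) rfl
    rw [← hf, h, hf]
  have hspan : Submodule.span K (Set.range fun j => grad (F j)) =
      Submodule.span K (Set.range fun x : s => grad (x : MvPolynomial σ ℂ)) := by
    rw [← Set.image_eq_range]
    apply le_antisymm
    · rw [Submodule.span_le]
      rintro _ ⟨j, rfl⟩
      exact grad_mem_span_of_isAlgebraic s (halg j)
    · apply Submodule.span_mono
      rintro _ ⟨x, hx, rfl⟩
      obtain ⟨j, rfl⟩ := hsF hx
      exact ⟨j, rfl⟩
  have : Finite s := by
    have := hLI.lt_aleph0_of_finiteDimensional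
    rwa [Cardinal.lt_aleph0_iff_finite] at this
  have := Fintype.ofFinite s
  rw [jacRank, hspan, finrank_span_eq_card hLI, ← hu.cardinalMk_eq_trdeg,
    ← Cardinal.mk_fintype, hs, Cardinal.mk_image_eq Subtype.val_injective]

end

/-- If the degrees agreed, a transcendence basis y of B would lift to a transcendence basis x of A.
Then a would divide some nonzero polynomial expression p(x), and applying φ gives p(y) = 0,
contradicting independence of y. -/
theorem trdeg_lt_of_surjective {k : Type*} {A B : Type*} [Field k] [CommRing A] [IsDomain A]
    [Algebra k A]
    [CommRing B] [IsDomain B] [Algebra k B] [Algebra.FiniteType k A] (φ : A →ₐ[k] B)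
    (hφ : Function.Surjective φ) {a : A} (ha : a ≠ 0) (hφa : φ a = 0) :
    (Algebra.trdeg k B).toNat < (Algebra.trdeg k A).toNat := by
  have hA : Algebra.trdeg k A < Cardinal.aleph0 := trdeg_lt_aleph0_of_finiteType
  have : Algebra.FiniteType k B := Algebra.FiniteType.of_surjective φ hφ
  have hB : Algebra.trdeg k B < Cardinal.aleph0 := trdeg_lt_aleph0_of_finiteType
  have hle := lift_trdeg_le_of_surjective φ hφ
  have hle' : (Algebra.trdeg k B).toNat ≤ (Algebra.trdeg k A).toNat := by
    rw [← Cardinal.toNat_lift, ← Cardinal.toNat_lift (Algebra.trdeg k A)]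
    exact Cardinal.toNat_le_toNat hle (Cardinal.lift_lt_aleph0.mpr hA)
  refine lt_of_le_of_ne hle' fun heq => ?_
  obtain ⟨ι, y, hy⟩ := exists_isTranscendenceBasis' k B
  choose x hx using fun i => hφ (y i)
  have hyx : φ ∘ x = y := funext hx
  have hxi : AlgebraicIndependent k x := AlgebraicIndependent.of_comp φ (hyx ▸ hy.1)
  have hxb : IsTranscendenceBasis k x := by
    refine hxi.isTranscendenceBasis_of_lift_trdeg_le hA ?_
    rw [← Cardinal.lift_lt_aleph0.{_, u_2}] at hB
    have h1 := hy.cardinalMk_eq_trdeg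
    rw [h1]
    refine le_of_eq (Cardinal.toNat_injOn (Cardinal.lift_lt_aleph0.mpr hA) hB ?_)
    rw [Cardinal.toNat_lift, Cardinal.toNat_lift, heq]
  obtain ⟨r, hr0, hr⟩ := (hxb.isAlgebraic.isAlgebraic a).exists_nonzero_dvd
    (mem_nonZeroDivisors_of_ne_zero ha)
  have hφr : φ (r : A) = 0 := by
    obtain ⟨c, hc⟩ := hr
    change (r : A) = a * c at hc
    rw [hc, map_mul, hφa, zero_mul]
  have hrm : (r : A) ∈ (aeval x : MvPolynomial ι k →ₐ[k] A).range := by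
    rw [← Algebra.adjoin_range_eq_range_aeval]
    exact r.2
  obtain ⟨p, hp⟩ := hrm
  have hp' : aeval x p = (r : A) := hp
  have hp0 : aeval y p = 0 := by
    have h1 : aeval (fun i => φ (x i)) p = φ (aeval x p) := by
      rw [← comp_aeval, AlgHom.comp_apply]
    rw [← hyx, ← hφr, ← hp', ← h1]
    rfl
  apply hr0
  ext
  rw [← hp', hy.1.eq_zero_of_aeval_eq_zero p hp0, map_zero]
  rfl

/-! ### Cones, vanishing ideals and the Zariski topology -/

/-- `G` vanishes on the line through `v` iff all its homogeneous components vanish at `v`. -/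
theorem eval_line_eq_zero_iff {ι : Type*} (G : MvPolynomial ι ℂ) (v : ι → ℂ) :
    (∀ c : ℂ, eval (c • v) G = 0) ↔ ∀ m, eval v (homogeneousComponent m G) = 0 := by
  have key : ∀ c : ℂ, eval (c • v) G =
      (∑ m ∈ Finset.range (G.totalDegree + 1),
        Polynomial.C (eval v (homogeneousComponent m G)) * Polynomial.X ^ m).eval c := by
    intro c
    conv_lhs => rw [← sum_homogeneousComponent G]
    simp only [map_sum, Polynomial.eval_finsetSum, Polynomial.eval_mul, Polynomial.eval_C,
      Polynomial.eval_pow, Polynomial.eval_X]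
    refine Finset.sum_congr rfl fun m _ => ?_
    rw [eval_smul (homogeneousComponent_isHomogeneous m G), mul_comm]
  constructor
  · intro h m
    by_cases hm : m < G.totalDegree + 1
    · have h0 : (∑ m ∈ Finset.range (G.totalDegree + 1),
        Polynomial.C (eval v (homogeneousComponent m G)) * Polynomial.X ^ m) = 0 :=
        Polynomial.funext fun c => by rw [← key, h]; simp
      have := congrArg (Polynomial.coeff · m) h0
      simpa [Polynomial.finsetSum_coeff, Polynomial.coeff_C_mul, Polynomial.coeff_X_pow,
        Finset.sum_ite_eq, hm, Nat.lt_succ_iff] using this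
    · rw [homogeneousComponent_eq_zero m G (by omega), map_zero]
  · intro h c
    rw [key]
    simp [h]

/-- The points of projective space over which `G` vanishes on the whole line. -/
def coneZero {ι : Type*} (G : MvPolynomial ι ℂ) : Set (Proj ι) :=
  {p | ∀ c : ℂ, eval (c • p.rep) G = 0}

/-- Here G need not be homogeneous: vanishing on a whole line is vanishing of all homogeneous
components. This lets the ideal of a cone be handled without gradings. -/
theorem isClosed_coneZero {ι : Type*} (G : MvPolynomial ι ℂ) : IsClosed (coneZero G) := by
  rw [isClosed_iff]
  refine ⟨Set.range fun m => homogeneousComponent m G, ?_, ?_⟩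
  · rintro _ ⟨m, rfl⟩
    exact ⟨m, homogeneousComponent_isHomogeneous m G⟩
  · ext p
    simp only [coneZero, zeroLocus, Set.mem_ofPred_eq, eval_line_eq_zero_iff, Set.forall_mem_range]

theorem mk_mem_coneZero {ι : Type*} (G : MvPolynomial ι ℂ) (v : ι → ℂ) (hv : v ≠ 0) :
    Projectivization.mk ℂ v hv ∈ coneZero G ↔ ∀ c : ℂ, eval (c • v) G = 0 := by
  obtain ⟨a, ha⟩ := Projectivization.exists_smul_eq_mk_rep ℂ v hv
  simp only [coneZero, Set.mem_ofPred_eq, ← ha, Units.smul_def, smul_smul]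
  constructor
  · intro h c
    simpa using h (c * (a : ℂ)⁻¹)
  · intro h c
    exact h _

/-- The ideal of the affine cone over a subset of projective space. -/
def coneIdeal {ι : Type*} (S : Set (Proj ι)) : Ideal (MvPolynomial ι ℂ) where
  carrier := {G | S ⊆ coneZero G}
  add_mem' := by
    intro a b ha hb p hp c
    rw [map_add, ha hp c, hb hp c, add_zero]
  zero_mem' := by
    intro p _ c
    exact map_zero _
  smul_mem' := by
    intro r a ha p hp c
    rw [smul_eq_mul, map_mul, ha hp c, mul_zero]

theorem mem_coneIdeal {ι : Type*} {S : Set (Proj ι)} {G : MvPolynomial ι ℂ} :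
    G ∈ coneIdeal S ↔ S ⊆ coneZero G := Iff.rfl

theorem coneIdeal_anti {ι : Type*} {S T : Set (Proj ι)} (h : S ⊆ T) :
    coneIdeal T ≤ coneIdeal S := fun _ hG => h.trans hG

theorem coneIdeal_closure {ι : Type*} (S : Set (Proj ι)) :
    coneIdeal (closure S) = coneIdeal S :=
  le_antisymm (coneIdeal_anti subset_closure) fun G hG =>
    closure_minimal hG (isClosed_coneZero G)

/-- No Nullstellensatz is needed: the forms that cut out T already lie in its ideal. -/
theorem subset_of_coneIdeal_le {ι : Type*} {S T : Set (Proj ι)} (hT : IsClosed T)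
    (h : coneIdeal T ≤ coneIdeal S) : S ⊆ T := by
  obtain ⟨E, hE, rfl⟩ := (isClosed_iff T).mp hT
  intro p hp G hG
  have hGT : G ∈ coneIdeal (zeroLocus E) := by
    intro q hq c
    obtain ⟨m, hm⟩ := hE G hG
    rw [eval_smul hm, hq G hG, mul_zero]
  simpa using h hGT hp 1

/-- Restricted to a line, polynomials become elements of the domain ℂ[c]. -/
theorem coneZero_mul {ι : Type*} (G H : MvPolynomial ι ℂ) :
    coneZero (G * H) = coneZero G ∪ coneZero H := by
  ext p
  have key : ∀ F : MvPolynomial ι ℂ, p ∈ coneZero F ↔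
      aeval (fun i => Polynomial.C (p.rep i) * Polynomial.X) F = (0 : Polynomial ℂ) := by
    intro F
    have h1 : ∀ c : ℂ, eval (c • p.rep) F =
        (aeval (fun i => Polynomial.C (p.rep i) * Polynomial.X) F : Polynomial ℂ).eval c := by
      intro c
      induction F using MvPolynomial.induction_on with
      | C a => simp
      | add F₁ F₂ h₁ h₂ => simp [h₁, h₂]
      | mul_X F i h => simp [h, mul_comm c]
    constructor
    · intro h
      exact Polynomial.funext fun c => by rw [← h1, h c]; simp
    · intro h c
      rw [h1, h]; simp
  simp only [Set.mem_union, key, map_mul, mul_eq_zero]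

theorem coneIdeal_isPrime {ι : Type*} {S : Set (Proj ι)} (hS : IsIrreducible S) :
    (coneIdeal S).IsPrime := by
  refine ⟨?_, ?_⟩
  · rw [Ideal.ne_top_iff_one]
    intro h
    obtain ⟨p, hp⟩ := hS.nonempty
    simpa using h hp 1
  · intro G H hGH
    rw [mem_coneIdeal, coneZero_mul] at hGH
    exact isPreirreducible_iff_isClosed_union_isClosed.mp hS.isPreirreducible _ _
      (isClosed_coneZero G) (isClosed_coneZero H) hGH

/-! ### Images of rational maps -/

section Image

variable {σ ι : Type*} {F : ι → MvPolynomial σ ℂ} {m : ℕ}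

theorem eval_aeval_family (v : σ → ℂ) (F : ι → MvPolynomial σ ℂ) (G : MvPolynomial ι ℂ) :
    eval v (aeval F G) = eval (fun j => eval v (F j)) G := by
  induction G using MvPolynomial.induction_on with
  | C a => simp
  | add F₁ F₂ h₁ h₂ => rw [map_add, map_add, map_add, h₁, h₂]
  | mul_X F i h => rw [map_mul, map_mul, map_mul, h, aeval_X, eval_X]

/-- If G vanishes on the cone, then F_j · G(F) vanishes everywhere for a fixed F_j ≠ 0, and F_j
cancels. Conversely, m-th roots exist in ℂ, so c F(v) = F(t v) with t^m = c, and the whole line over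
F(v) consists of values of F. -/
theorem mem_coneIdeal_ran_iff (hF : ∀ j, (F j).IsHomogeneous m) (hm : m ≠ 0) (hF0 : F ≠ 0)
    (G : MvPolynomial ι ℂ) : G ∈ coneIdeal (ratMap F).ran ↔ aeval F G = 0 := by
  have hev := fun v => eval_aeval_family v F G
  constructor
  · intro h
    obtain ⟨j, hj⟩ := Function.ne_iff.mp hF0
    have h0 : F j * aeval F G = 0 := by
      refine MvPolynomial.funext fun v => ?_
      rw [map_mul, map_zero, mul_eq_zero, or_iff_not_imp_left]
      intro hvj
      have hv0 : v ≠ 0 := by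
        rintro rfl
        have := eval_smul (hF j) 0 0
        rw [zero_pow hm, zero_mul, smul_zero] at this
        exact hvj this
      have hFv : (fun j => eval v (F j)) ≠ 0 := fun h => hvj (congrFun h j)
      have hq : Projectivization.mk ℂ _ hFv ∈ (ratMap F).ran :=
        ⟨Projectivization.mk ℂ v hv0, (mem_ratMap_mk hF v hv0 _).mpr ⟨hFv, rfl⟩⟩
      have := (mk_mem_coneZero G _ hFv).mp (h hq) 1
      rw [one_smul] at this
      rw [hev, this]
    exact (mul_eq_zero.mp h0).resolve_left hj
  · rintro h q ⟨p, hq⟩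
    induction p using Projectivization.ind with | _ v hv =>
    obtain ⟨hFv, rfl⟩ := (mem_ratMap_mk hF v hv q).mp hq
    rw [mk_mem_coneZero]
    intro c
    obtain ⟨t, rfl⟩ := IsAlgClosed.exists_pow_nat_eq c (Nat.pos_of_ne_zero hm)
    have : (t ^ m • fun j => eval v (F j)) = fun j => eval (t • v) (F j) := by
      funext j
      rw [eval_smul (hF j)]; rfl
    rw [this, ← hev, h, map_zero]

theorem coneIdeal_closure_ran (hF : ∀ j, (F j).IsHomogeneous m) (hm : m ≠ 0) (hF0 : F ≠ 0) :
    coneIdeal (closure (ratMap F).ran) =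
      RingHom.ker (aeval F : MvPolynomial ι ℂ →ₐ[ℂ] MvPolynomial σ ℂ) := by
  rw [coneIdeal_closure]
  ext G
  rw [mem_coneIdeal_ran_iff hF hm hF0, RingHom.mem_ker]

/-- The ideal of the closure is the kernel of a map to a domain, hence prime. -/
theorem isIrreducible_closure_ran (hF : ∀ j, (F j).IsHomogeneous m) (hm : m ≠ 0) (hF0 : F ≠ 0) :
    IsIrreducible (closure (ratMap F).ran) := by
  refine ⟨?_, isPreirreducible_iff_isClosed_union_isClosed.mpr ?_⟩
  · by_contra h
    rw [Set.not_nonempty_iff_eq_empty] at h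
    have h1 : (1 : MvPolynomial ι ℂ) ∈ coneIdeal (closure (ratMap F).ran) := by
      rw [h]; exact Set.empty_subset _
    rw [coneIdeal_closure_ran hF hm hF0, RingHom.mem_ker, map_one] at h1
    exact one_ne_zero h1
  · intro Z₁ Z₂ hZ₁ hZ₂ hZ
    by_contra! hc
    have aux : ∀ Z : Set (Proj ι), IsClosed Z → ¬ closure (ratMap F).ran ⊆ Z →
        ∃ G ∈ coneIdeal Z, G ∉ coneIdeal (closure (ratMap F).ran) := by
      intro Z hZ h
      contrapose! h
      exact subset_of_coneIdeal_le hZ h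
    obtain ⟨G, hG, hG'⟩ := aux Z₁ hZ₁ hc.1
    obtain ⟨H, hH, hH'⟩ := aux Z₂ hZ₂ hc.2
    have hGH : G * H ∈ coneIdeal (closure (ratMap F).ran) := by
      rw [mem_coneIdeal, coneZero_mul]
      exact hZ.trans (Set.union_subset_union hG hH)
    rw [coneIdeal_closure_ran hF hm hF0, RingHom.mem_ker] at hG' hH' hGH
    rw [map_mul, mul_eq_zero] at hGH
    exact hGH.elim hG' hH'

end Image

/-! ### The dimension of a projective variety through its homogeneous coordinate ring -/

/-- The transcendence degree of the homogeneous coordinate ring. -/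
def coneDim {ι : Type*} (S : Set (Proj ι)) : ℕ :=
  (Algebra.trdeg ℂ (MvPolynomial ι ℂ ⧸ coneIdeal S)).toNat

theorem coneDim_closure_ran {σ : Type} [Finite σ] {ι : Type*} {F : ι → MvPolynomial σ ℂ} {m : ℕ}
    (hF : ∀ j, (F j).IsHomogeneous m) (hm : m ≠ 0) (hF0 : F ≠ 0) :
    coneDim (closure (ratMap F).ran) = jacRank F := by
  rw [coneDim, coneIdeal_closure_ran hF hm hF0]
  have e := Ideal.quotientKerEquivRange (R := ℂ)
    (aeval F : MvPolynomial ι ℂ →ₐ[ℂ] MvPolynomial σ ℂ)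
  rw [← Algebra.adjoin_range_eq_range_aeval] at e
  rw [← Cardinal.toNat_lift, e.lift_trdeg_eq, trdeg_adjoin_eq_jacRank]
  simp

theorem coneDim_lt {ι : Type*} [Finite ι] {S T : Set (Proj ι)} (hS : IsIrreducible S)
    (hT : IsIrreducible T) (hSc : IsClosed S) (hST : S ⊂ T) : coneDim S < coneDim T := by
  have := coneIdeal_isPrime hS
  have := coneIdeal_isPrime hT
  have hle := coneIdeal_anti hST.1
  obtain ⟨G, hG, hG'⟩ : ∃ G ∈ coneIdeal S, G ∉ coneIdeal T := by
    by_contra! h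
    exact hST.2 (subset_of_coneIdeal_le hSc h)
  refine trdeg_lt_of_surjective (Ideal.Quotient.factorₐ ℂ hle)
    (Ideal.Quotient.factor_surjective hle) (a := Ideal.Quotient.mk _ G) ?_ ?_
  · rwa [ne_eq, Ideal.Quotient.eq_zero_iff_mem]
  · change Ideal.Quotient.factor hle _ = 0
    rwa [Ideal.Quotient.factor_mk, Ideal.Quotient.eq_zero_iff_mem]

/-- Evaluation at the vertex of the cone is a surjection of the coordinate ring onto ℂ that kills
some nonzero coordinate, so the degree drops strictly. This accounts for the shift by one between
cone and projective dimension. -/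
theorem coneDim_pos {ι : Type*} [Finite ι] {S : Set (Proj ι)} (hS : IsIrreducible S) :
    0 < coneDim S := by
  have := coneIdeal_isPrime hS
  obtain ⟨p, hp⟩ := hS.nonempty
  obtain ⟨j, hj⟩ := Function.ne_iff.mp p.rep_nonzero
  have h0 : ∀ G ∈ coneIdeal S, aeval (0 : ι → ℂ) G = 0 := by
    intro G hG
    have := hG hp 0
    rwa [zero_smul] at this
  refine lt_of_le_of_lt (Nat.zero_le _) (trdeg_lt_of_surjective
    (Ideal.Quotient.liftₐ (coneIdeal S) (aeval (0 : ι → ℂ)) h0) (fun c => ?_)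
    (a := Ideal.Quotient.mk _ (X j)) ?_ ?_)
  · exact ⟨algebraMap ℂ _ c, by rw [AlgHom.commutes]; rfl⟩
  · rw [ne_eq, Ideal.Quotient.eq_zero_iff_mem]
    intro h
    apply hj
    simpa using h hp 1
  · change aeval (0 : ι → ℂ) (X j) = 0
    simp

/-! ### Ranks of matrices of polynomials -/

theorem exists_linearIndependent_row_comp {K m n : Type*} [Field K] [Finite m] [Fintype n]
    (M : Matrix m n K) {r : ℕ} (h : r ≤ M.rank) :
    ∃ e : Fin r → m, LinearIndependent K (M.row ∘ e) := by
  obtain ⟨κ, a, ha, hspan, hLI⟩ := exists_linearIndependent' K M.row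
  have : Finite κ := Finite.of_injective a ha
  have := Fintype.ofFinite κ
  rw [Matrix.rank_eq_finrank_span_row, ← hspan, finrank_span_eq_card hLI] at h
  obtain ⟨g⟩ : Nonempty (Fin r ↪ κ) :=
    Function.Embedding.nonempty_of_card_le (by simpa using h)
  exact ⟨a ∘ g, hLI.comp g g.injective⟩

theorem exists_det_submatrix_ne_zero {K m n : Type*} [Field K] [Finite m] [Fintype n]
    (M : Matrix m n K) {r : ℕ} (h : r ≤ M.rank) :
    ∃ (e : Fin r → m) (f : Fin r → n), (M.submatrix e f).det ≠ 0 := by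
  obtain ⟨e, he⟩ := exists_linearIndependent_row_comp M h
  have h1 : (M.submatrix e id).rank = r := by
    have := LinearIndependent.rank_matrix (M := M.submatrix e id) he
    simpa using this
  obtain ⟨f, hf⟩ := exists_linearIndependent_row_comp (M.submatrix e id).transpose
    (r := r) (by rw [Matrix.rank_transpose, h1])
  refine ⟨e, f, ?_⟩
  rw [← Matrix.det_transpose, ← isUnit_iff_ne_zero, ← Matrix.isUnit_iff_isUnit_det,
    ← Matrix.linearIndependent_rows_iff_isUnit]
  exact hf

theorem le_rank_of_det_submatrix_ne_zero {K m n : Type*} [Field K] [Finite m] [Fintype n]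
    (M : Matrix m n K) {r : ℕ} (e : Fin r → m) (f : Fin r → n)
    (h : (M.submatrix e f).det ≠ 0) : r ≤ M.rank := by
  rw [← isUnit_iff_ne_zero, ← Matrix.isUnit_iff_isUnit_det,
    ← Matrix.linearIndependent_rows_iff_isUnit] at h
  have h1 : LinearIndependent K (M.row ∘ e) :=
    LinearIndependent.of_comp (LinearMap.funLeft K K f) h
  rw [Matrix.rank_eq_finrank_span_row]
  have h2 := finrank_span_eq_card h1
  rw [Fintype.card_fin] at h2
  rw [← h2]
  exact Submodule.finrank_mono (Submodule.span_mono (Set.range_comp_subset_range _ _))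

section GenericRank

variable {σ ι κ : Type*} [Finite ι] [Fintype κ]

theorem rank_map_eval_le_genericRank (M : Matrix ι κ (MvPolynomial σ ℂ)) (v : σ → ℂ) :
    (M.map (eval v)).rank ≤ genericRank M := by
  obtain ⟨e, f, h⟩ := exists_det_submatrix_ne_zero (M.map (eval v)) le_rfl
  refine le_rank_of_det_submatrix_ne_zero _ e f fun h0 => h ?_
  rw [Matrix.submatrix_map, ← RingHom.mapMatrix_apply, ← RingHom.map_det,
    map_eq_zero_iff _ (IsFractionRing.injective _ _)] at h0
  rw [Matrix.submatrix_map, ← RingHom.mapMatrix_apply, ← RingHom.map_det, h0, map_zero]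

/-- A point where neither g nor a nonvanishing minor of maximal size is zero; g carries an extra
open condition on v. -/
theorem exists_genericRank_le_rank_map_eval (M : Matrix ι κ (MvPolynomial σ ℂ))
    {g : MvPolynomial σ ℂ} (hg : g ≠ 0) :
    ∃ v, eval v g ≠ 0 ∧ genericRank M ≤ (M.map (eval v)).rank := by
  obtain ⟨e, f, h⟩ := exists_det_submatrix_ne_zero
    (M.map (algebraMap (MvPolynomial σ ℂ) (FractionRing (MvPolynomial σ ℂ))))
    (r := genericRank M) le_rfl
  rw [Matrix.submatrix_map, ← RingHom.mapMatrix_apply, ← RingHom.map_det] at h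
  have h' : (M.submatrix e f).det ≠ 0 := fun h0 => h (by rw [h0, map_zero])
  obtain ⟨v, hv⟩ : ∃ v, eval v (g * (M.submatrix e f).det) ≠ 0 := by
    by_contra! hc
    exact mul_ne_zero hg h' (MvPolynomial.funext fun v => by rw [hc v, map_zero])
  rw [map_mul] at hv
  refine ⟨v, left_ne_zero_of_mul hv, le_rank_of_det_submatrix_ne_zero _ e f ?_⟩
  rw [Matrix.submatrix_map, ← RingHom.mapMatrix_apply, ← RingHom.map_det]
  exact right_ne_zero_of_mul hv

end GenericRank

/-- The Jacobian matrix of a family of polynomials. -/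
def jacobian {σ ι : Type*} (F : ι → MvPolynomial σ ℂ) : Matrix σ ι (MvPolynomial σ ℂ) :=
  Matrix.of fun l j => pderiv l (F j)

theorem genericRank_jacobian {σ ι : Type*} [Fintype ι] (F : ι → MvPolynomial σ ℂ) :
    genericRank (jacobian F) = jacRank F := by
  rw [genericRank, Matrix.rank_eq_finrank_span_cols, jacRank]
  have : (fun j => grad (F j)) = ((jacobian F).map
      (algebraMap (MvPolynomial σ ℂ) (FractionRing (MvPolynomial σ ℂ)))).col := by
    funext j l
    exact grad_apply _ _
  rw [this]

theorem jacRank_le_card {σ ι : Type*} [Fintype σ] (F : ι → MvPolynomial σ ℂ) :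
    jacRank F ≤ Fintype.card σ :=
  (Submodule.finrank_le _).trans (by rw [Module.finrank_pi])

/-! ### Restriction to linear subspaces -/

theorem pderiv_aeval {σ τ : Type*} [Fintype σ] (θ : σ → MvPolynomial τ ℂ) (i : τ)
    (g : MvPolynomial σ ℂ) :
    pderiv i (aeval θ g) = ∑ l, aeval θ (pderiv l g) * pderiv i (θ l) := by
  classical
  induction g using MvPolynomial.induction_on with
  | C a => simp
  | add p q hp hq => simp only [map_add, hp, hq, add_mul, Finset.sum_add_distrib]
  | mul_X p s hp =>
    simp only [map_mul, aeval_X, Derivation.leibniz, hp, smul_eq_mul, map_add, add_mul,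
      Finset.sum_add_distrib, pderiv_X, Finset.mul_sum]
    congr 1
    · rw [Finset.sum_eq_single s]
      · simp
      · intro b _ hb
        simp [Ne.symm hb]
      · simp
    · exact Finset.sum_congr rfl fun l _ => by ring

/-- The restriction of polynomials to the span of the vectors `w i`, in the coordinates given
by the `w i`. -/
def restrictSpan {σ τ ι : Type*} [Fintype τ] (w : τ → σ → ℂ) (F : ι → MvPolynomial σ ℂ) :
    ι → MvPolynomial τ ℂ :=
  fun j => aeval (fun l => ∑ i, C (w i l) * X i) (F j)

section Restrict

variable {σ τ ι : Type*} [Fintype τ] (w : τ → σ → ℂ) (F : ι → MvPolynomial σ ℂ)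

theorem eval_restrictSpan (t : τ → ℂ) (j : ι) :
    eval t (restrictSpan w F j) = eval (∑ i, t i • w i) (F j) := by
  rw [restrictSpan, eval_aeval_family]
  congr 2
  funext l
  simp [mul_comm]

theorem restrictSpan_isHomogeneous {m : ℕ} {F : ι → MvPolynomial σ ℂ}
    (hF : ∀ j, (F j).IsHomogeneous m) (j : ι) : (restrictSpan w F j).IsHomogeneous m := by
  have := (hF j).aeval (fun l => ∑ i, C (w i l) * X i : σ → MvPolynomial τ ℂ) (n := 1)
    (fun l => IsHomogeneous.sum _ _ _ fun i _ => isHomogeneous_C_mul_X _ _)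
  rwa [one_mul] at this

/-- Chain rule: row i of the restricted Jacobian is the differential of F applied to the vector w i.
-/
theorem eval_jacobian_restrictSpan [Fintype σ] (t : τ → ℂ) (i : τ) (j : ι) :
    eval t (jacobian (restrictSpan w F) i j) =
      ((jacobian F).map (eval (∑ i, t i • w i))).transpose.mulVec (w i) j := by
  classical
  simp only [jacobian, Matrix.of_apply, restrictSpan, pderiv_aeval, map_sum, map_mul,
    Matrix.mulVec, dotProduct, Matrix.transpose_apply, Matrix.map_apply]
  refine Finset.sum_congr rfl fun l _ => ?_
  have := eval_restrictSpan w (fun _ : Unit => pderiv l (F j)) t ()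
  rw [restrictSpan] at this
  rw [this]
  congr 1
  rw [Finset.sum_eq_single i]
  · simp
  · intro b _ hb
    simp [pderiv_X, hb]
  · simp

end Restrict

/-! ### The dimension of the image of a rational map -/

theorem exists_linearIndependent_zero_eq {K V : Type*} [Field K] [AddCommGroup V] [Module K V]
    {x : V} (hx : x ≠ 0) (s : ℕ) (hs : s + 1 ≤ Module.finrank K V) :
    ∃ y : Fin (s + 1) → V, LinearIndependent K y ∧ y 0 = x := by
  induction s with
  | zero => exact ⟨![x], by simpa [linearIndependent_unique_iff] using hx, rfl⟩
  | succ s ih =>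
    obtain ⟨y, hy, hy0⟩ := ih (by omega)
    obtain ⟨z, hz⟩ := exists_linearIndependent_snoc_of_lt_finrank hy hs
    refine ⟨Fin.snoc y z, hz, ?_⟩
    rw [← Fin.castSucc_zero, Fin.snoc_castSucc, hy0]

theorem isIrreducible_of_image {X Y : Type*} [TopologicalSpace X] [TopologicalSpace Y]
    {f : X → Y} (hf : Topology.IsInducing f) {s : Set X} (hs : IsIrreducible (f '' s)) :
    IsIrreducible s := by
  refine ⟨hs.nonempty.of_image, fun u v hu hv hsu hsv => ?_⟩
  obtain ⟨u', hu', rfl⟩ := hf.isOpen_iff.mp hu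
  obtain ⟨v', hv', rfl⟩ := hf.isOpen_iff.mp hv
  obtain ⟨_, ⟨x, hx, rfl⟩, hxu, hxv⟩ := hs.isPreirreducible u' v' hu' hv'
    (hsu.elim fun x hx => ⟨f x, ⟨x, hx.1, rfl⟩, hx.2⟩)
    (hsv.elim fun x hx => ⟨f x, ⟨x, hx.1, rfl⟩, hx.2⟩)
  exact ⟨x, hx, hxu, hxv⟩

section Dimension

variable {n : ℕ} {ι : Type*} {F : ι → MvPolynomial (Fin n) ℂ} {m : ℕ}

/-- Along a chain of irreducible closed subsets `coneDim` increases strictly from at least 1 to at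
most r + 1. -/
theorem topologicalKrullDim_closure_ran_le [Finite ι] (hF : ∀ j, (F j).IsHomogeneous m)
    (hm : m ≠ 0) (hF0 : F ≠ 0) {r : ℕ} (hr : jacRank F = r + 1) :
    topologicalKrullDim (closure (ratMap F).ran) ≤ r := by
  set Z := closure (ratMap F).ran with hZ
  have hirr : ∀ W : TopologicalSpace.IrreducibleCloseds Z,
      IsIrreducible ((↑) '' (W : Set Z) : Set (Proj ι)) := fun W =>
    W.isIrreducible.image _ continuous_subtype_val.continuousOn
  have hcl : ∀ W : TopologicalSpace.IrreducibleCloseds Z,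
      IsClosed ((↑) '' (W : Set Z) : Set (Proj ι)) := fun W =>
    isClosed_closure.isClosedEmbedding_subtypeVal.isClosedMap _ W.isClosed
  have hmono : StrictMono fun W : TopologicalSpace.IrreducibleCloseds Z =>
      coneDim ((↑) '' (W : Set Z) : Set (Proj ι)) := by
    intro W W' h
    exact coneDim_lt (hirr W) (hirr W') (hcl W)
      (Subtype.val_injective.image_strictMono h)
  rw [topologicalKrullDim, Order.krullDim]
  refine iSup_le fun p => ?_
  have h1 := LTSeries.head_add_length_le_nat (p.map _ hmono)
  have h2 : 0 < (p.map _ hmono).head := coneDim_pos (hirr _)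
  have h3 : (p.map _ hmono).last ≤ r + 1 := by
    rw [← hr, ← coneDim_closure_ran hF hm hF0]
    change coneDim ((↑) '' (p.last : Set Z) : Set (Proj ι)) ≤ coneDim Z
    have hsub : ((↑) '' (p.last : Set Z) : Set (Proj ι)) ⊆ Z := by
      rintro _ ⟨z, _, rfl⟩
      exact z.2
    rcases hsub.eq_or_ssubset with h | h
    · rw [h]
    · exact (coneDim_lt (hirr _) (isIrreducible_closure_ran hF hm hF0) (hcl _) h).le
  have h4 : (p.map _ hmono).length = p.length := rfl
  have h5 : p.length ≤ r := by omega
  exact_mod_cast h5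

theorem jacRank_restrictSpan [Fintype ι] {s : ℕ} (w : Fin (s + 1) → Fin n → ℂ)
    (hw : LinearIndependent ℂ fun i =>
      ((jacobian F).map (eval (w 0))).transpose.mulVec (w i)) :
    jacRank (restrictSpan w F) = s + 1 := by
  apply le_antisymm
  · simpa using jacRank_le_card (restrictSpan w F)
  · rw [← genericRank_jacobian]
    refine le_trans ?_ (rank_map_eval_le_genericRank _ (Pi.single 0 1))
    have h0 : ∑ i, (Pi.single 0 1 : Fin (s + 1) → ℂ) i • w i = w 0 := by
      rw [Finset.sum_eq_single 0]
      · simp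
      · intro b _ hb
        simp [hb]
      · simp
    have : LinearIndependent ℂ
        ((jacobian (restrictSpan w F)).map (eval (Pi.single 0 1))).row := by
      convert hw using 1
      funext i j
      rw [Matrix.row, Matrix.map_apply, eval_jacobian_restrictSpan, h0]
    rw [this.rank_matrix, Fintype.card_fin]

/-- At a general v the differential T has rank at least r + 1. Take w_0 = v, …, w_r with independent
images under T; the restrictions of F to the spans of w_0, …, w_i have image closures of cone
dimension i + 1, forming a strict chain. -/
theorem le_topologicalKrullDim_closure_ran [Fintype ι] (hF : ∀ j, (F j).IsHomogeneous m)
    (hm : m ≠ 0) (hF0 : F ≠ 0) {r : ℕ} (hr : jacRank F = r + 1) :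
    r ≤ topologicalKrullDim (closure (ratMap F).ran) := by
  obtain ⟨j₀, hj₀⟩ := Function.ne_iff.mp hF0
  obtain ⟨v, hv, hrank⟩ := exists_genericRank_le_rank_map_eval (jacobian F) hj₀
  rw [genericRank_jacobian, hr, ← Matrix.rank_transpose, Matrix.rank] at hrank
  set T := ((jacobian F).map (eval v)).transpose.mulVecLin with hT
  -- By Euler's formula T v = m F(v), so v itself can be the first vector of the flag.
  have hTv : T v ≠ 0 := by
    have h1 : T v j₀ = m * eval v (F j₀) := by
      have := congrArg (eval v) (hF j₀).sum_X_mul_pderiv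
      simp only [map_sum, map_mul, eval_X, nsmul_eq_mul, map_natCast] at this
      rw [← this, hT, Matrix.mulVecLin_apply, Matrix.mulVec, dotProduct]
      exact Finset.sum_congr rfl fun l _ => mul_comm _ _
    intro h
    rw [h] at h1
    exact mul_ne_zero (Nat.cast_ne_zero.mpr hm) hv h1.symm
  obtain ⟨y, hy, hy0⟩ := exists_linearIndependent_zero_eq
    (x := (⟨T v, v, rfl⟩ : LinearMap.range T)) (fun h => hTv (congrArg Subtype.val h)) r hrank
  have hex : ∀ i, ∃ u, T u = y i ∧ (i = 0 → u = v) := by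
    intro i
    by_cases hi : i = 0
    · subst hi
      exact ⟨v, by rw [hy0], fun _ => rfl⟩
    · obtain ⟨u, hu⟩ := (y i).2
      exact ⟨u, hu, fun h => absurd h hi⟩
  choose w hw hw0 using hex
  have hTw : LinearIndependent ℂ fun i => T (w i) := by
    simp only [hw]
    exact hy.map' (Submodule.subtype _) (Submodule.ker_subtype _)
  let q : (i : Fin (r + 1)) → Fin (i + 1) → Fin n → ℂ := fun i a => w (Fin.castLE (by omega) a)
  have hq0 : ∀ i, q i 0 = v := fun i => hw0 _ rfl
  let G : (i : Fin (r + 1)) → ι → MvPolynomial (Fin (i + 1)) ℂ := fun i => restrictSpan (q i) F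
  have hG : ∀ i j, (G i j).IsHomogeneous m := fun i => restrictSpan_isHomogeneous _ hF
  have hG0 : ∀ i, G i ≠ 0 := by
    intro i h
    have h1 := eval_restrictSpan (q i) F (Pi.single 0 1) j₀
    rw [show restrictSpan (q i) F j₀ = 0 from congrFun h j₀, map_zero,
      Finset.sum_eq_single 0] at h1
    · rw [hq0, Pi.single_eq_same, one_smul] at h1
      exact hv h1.symm
    · intro b _ hb
      simp [hb]
    · simp
  have hGr : ∀ i, jacRank (G i) = i + 1 := by
    intro i
    refine jacRank_restrictSpan (q i) ?_
    rw [hq0]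
    exact hTw.comp (Fin.castLE (by omega)) (Fin.castLE_injective _)
  -- If every value of F₁ is a value of F₂, then relations among the F₂ are relations among the F₁,
  -- which gives the inclusion of closures.
  have hsub : ∀ {s t : ℕ} (F₁ : ι → MvPolynomial (Fin s) ℂ) (F₂ : ι → MvPolynomial (Fin t) ℂ)
      (_ : ∀ j, (F₁ j).IsHomogeneous m) (_ : ∀ j, (F₂ j).IsHomogeneous m)
      (_ : F₁ ≠ 0) (_ : F₂ ≠ 0) (_ : ∀ u, ∃ u', ∀ j, eval u (F₁ j) = eval u' (F₂ j)),
      closure (ratMap F₁).ran ⊆ closure (ratMap F₂).ran := by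
    intro s t F₁ F₂ h₁ h₂ h₁' h₂' h
    refine subset_of_coneIdeal_le isClosed_closure fun H hH => ?_
    rw [coneIdeal_closure_ran h₂ hm h₂', RingHom.mem_ker] at hH
    rw [coneIdeal_closure_ran h₁ hm h₁', RingHom.mem_ker]
    refine MvPolynomial.funext fun u => ?_
    obtain ⟨u', hu'⟩ := h u
    rw [eval_aeval_family]
    simp only [hu']
    rw [← eval_aeval_family, hH, map_zero, map_zero]
  set Z := closure (ratMap F).ran with hZ
  have hGZ : ∀ i, closure (ratMap (G i)).ran ⊆ Z := fun i =>
    hsub _ _ (hG i) hF (hG0 i) hF0 fun u => ⟨_, fun j => eval_restrictSpan _ _ _ _⟩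
  have hmono : ∀ i i', i < i' → closure (ratMap (G i)).ran ⊂ closure (ratMap (G i')).ran := by
    intro i i' hi
    have hle : (i : ℕ) + 1 ≤ i' + 1 := Nat.succ_le_succ hi.le
    -- A point of the smaller span is the same point of the larger one, with coordinates padded by
    -- zeros.
    refine (hsub _ _ (hG i) (hG i') (hG0 i) (hG0 i') fun u =>
      ⟨fun b => if h : (b : ℕ) < i + 1 then u ⟨b, h⟩ else 0, fun j => ?_⟩).ssubset_of_ne ?_
    · rw [eval_restrictSpan, eval_restrictSpan]
      congr 2
      refine Finset.sum_of_injOn (Fin.castLE hle) (Fin.castLE_injective hle).injOn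
        (fun _ _ => Finset.mem_coe.mpr (Finset.mem_univ _)) (fun b _ hb => ?_) (fun a _ => ?_)
      · rw [dif_neg, zero_smul]
        intro h
        exact hb ⟨⟨b, h⟩, by simp, rfl⟩
      · rw [dif_pos (show ((Fin.castLE hle a : Fin _) : ℕ) < i + 1 from a.2)]
        rfl
    · intro h
      have := congrArg coneDim h
      rw [coneDim_closure_ran (hG i) hm (hG0 i), coneDim_closure_ran (hG i') hm (hG0 i'), hGr,
        hGr] at this
      have := Fin.lt_def.mp hi
      omega
  have himg : ∀ i, ((↑) '' ((↑) ⁻¹' closure (ratMap (G i)).ran : Set Z) : Set (Proj ι)) =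
      closure (ratMap (G i)).ran := fun i => by
    rw [Subtype.image_preimage_coe, Set.inter_eq_right.mpr (hGZ i)]
  let W : Fin (r + 1) → TopologicalSpace.IrreducibleCloseds Z := fun i =>
    { carrier := (↑) ⁻¹' closure (ratMap (G i)).ran
      isIrreducible' := by
        have h := isIrreducible_closure_ran (hG i) hm (hG0 i)
        rw [← himg i] at h
        exact isIrreducible_of_image Topology.IsInducing.subtypeVal h
      isClosed' := isClosed_closure.preimage continuous_subtype_val }
  have hW : StrictMono W := by
    intro i i' hi
    refine lt_of_le_of_ne (fun z hz => (hmono i i' hi).1 hz) fun h => (hmono i i' hi).ne ?_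
    rw [← himg i, ← himg i']
    exact congrArg (fun V : TopologicalSpace.IrreducibleCloseds Z =>
      (Subtype.val '' (V : Set Z) : Set (Proj ι))) h
  rw [topologicalKrullDim]
  exact Order.le_krullDim_iff.mpr ⟨LTSeries.mk r W hW, rfl⟩

theorem jacRank_pos [Finite ι] (hF : ∀ j, (F j).IsHomogeneous m) (hm : m ≠ 0) (hF0 : F ≠ 0) :
    0 < jacRank F := by
  rw [← coneDim_closure_ran hF hm hF0]
  exact coneDim_pos (isIrreducible_closure_ran hF hm hF0)

/-- The closure of the image of the rational map given by forms of a common positive degree has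
dimension one less than the rank of the Jacobian matrix. -/
theorem topologicalKrullDim_closure_ran [Fintype ι] (hF : ∀ j, (F j).IsHomogeneous m)
    (hm : m ≠ 0) (hF0 : F ≠ 0) :
    topologicalKrullDim (closure (ratMap F).ran) = (jacRank F - 1 : ℕ) := by
  have hr : jacRank F = jacRank F - 1 + 1 := (Nat.succ_pred (jacRank_pos hF hm hF0).ne').symm
  exact le_antisymm (topologicalKrullDim_closure_ran_le hF hm hF0 hr)
    (le_topologicalKrullDim_closure_ran hF hm hF0 hr)

end Dimension

/-! ### Apolarity -/

section Apolarity

variable {σ : Type*}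

theorem diffOp_mul_apply (α β g : MvPolynomial σ ℂ) :
    diffOp (α * β) g = diffOp α (diffOp β g) := by
  rw [map_mul, Module.End.mul_apply]

theorem diffOp_C_mul (c : ℂ) (α g : MvPolynomial σ ℂ) : diffOp (C c * α) g = c • diffOp α g := by
  rw [← smul_eq_C_mul, map_smul, LinearMap.smul_apply]

/-- Euler's formula for the operator, (k+1) α = ∑ X_i ∂_i α, reduces to degree k. -/
theorem diffOp_isHomogeneous [Fintype σ] {k : ℕ} : ∀ {e : ℕ} {α g : MvPolynomial σ ℂ},
    α.IsHomogeneous k → g.IsHomogeneous e → (diffOp α g).IsHomogeneous (e - k) := by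
  induction k with
  | zero =>
    intro e α g hα hg
    rw [← totalDegree_zero_iff_isHomogeneous, totalDegree_eq_zero_iff_eq_C] at hα
    rw [hα, ← mul_one (C _), diffOp_C_mul, map_one]
    exact (homogeneousSubmodule σ ℂ e).smul_mem _ hg
  | succ k ih =>
    intro e α g hα hg
    have h1 : diffOp α g = ((k + 1 : ℕ) : ℂ)⁻¹ • ∑ i, pderiv i (diffOp (pderiv i α) g) := by
      have h2 := congrArg (fun β => diffOp β g) hα.sum_X_mul_pderiv
      simp only [map_sum, LinearMap.sum_apply, diffOp_mul_apply, diffOp_X, map_nsmul,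
        LinearMap.smul_apply] at h2
      rw [h2, ← Nat.cast_smul_eq_nsmul ℂ, inv_smul_smul₀ (Nat.cast_ne_zero.mpr k.succ_ne_zero)]
    rw [h1]
    refine (homogeneousSubmodule σ ℂ _).smul_mem _ (Submodule.sum_mem _ fun i _ => ?_)
    have h3 := (ih (hα.pderiv (i := i)) hg).pderiv (i := i)
    rwa [Nat.sub_sub] at h3

/-- Nondegeneracy of apolarity: by Euler, a nonzero form of positive degree has a nonzero partial
derivative; iterate. -/
theorem exists_diffOp_ne_zero [Fintype σ] {k : ℕ} : ∀ {e : ℕ} {g : MvPolynomial σ ℂ},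
    g.IsHomogeneous e → g ≠ 0 → k ≤ e →
      ∃ β : MvPolynomial σ ℂ, β.IsHomogeneous k ∧ diffOp β g ≠ 0 := by
  induction k with
  | zero => exact fun _ hg0 _ => ⟨1, isHomogeneous_one _ _, by simpa using hg0⟩
  | succ k ih =>
    intro e g hg hg0 hke
    obtain ⟨i, hi⟩ : ∃ i, pderiv i g ≠ 0 := by
      by_contra! h
      have h1 := hg.sum_X_mul_pderiv
      simp only [h, mul_zero, Finset.sum_const_zero] at h1
      rw [← Nat.cast_smul_eq_nsmul ℂ, eq_comm, smul_eq_zero, Nat.cast_eq_zero] at h1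
      rcases h1 with h1 | h1
      · omega
      · exact hg0 h1
    obtain ⟨β, hβ, hβg⟩ := ih (hg.pderiv (i := i)) hi (by omega)
    refine ⟨β * X i, hβ.mul (isHomogeneous_X ℂ i), ?_⟩
    rwa [diffOp_mul_apply, diffOp_X]

/-- The linear form with coefficient vector `v`. -/
def linForm [Fintype σ] (v : σ → ℂ) : MvPolynomial σ ℂ := ∑ i, C (v i) * X i

theorem linForm_isHomogeneous [Fintype σ] (v : σ → ℂ) : (linForm v).IsHomogeneous 1 :=
  IsHomogeneous.sum _ _ _ fun _ _ => isHomogeneous_C_mul_X _ _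

theorem exists_eq_linForm [Fintype σ] {l : MvPolynomial σ ℂ} (hl : l.IsHomogeneous 1) :
    ∃ v, l = linForm v := by
  rw [← mem_homogeneousSubmodule, homogeneousSubmodule_one_eq_span_X,
    Submodule.mem_span_range_iff_exists_fun] at hl
  obtain ⟨v, hv⟩ := hl
  exact ⟨v, by simp only [← hv, linForm, smul_eq_C_mul]⟩

theorem diffOp_linForm [Fintype σ] (v : σ → ℂ) (g : MvPolynomial σ ℂ) :
    diffOp (linForm v) g = ∑ i, v i • pderiv i g := by
  simp only [linForm, map_sum, LinearMap.sum_apply, diffOp_C_mul, diffOp_X]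

/-- One directional derivative along v, evaluated at v, multiplies by the degree. This links powers
of L to evaluation of the Hessian. -/
theorem diffOp_linForm_pow [Fintype σ] (v : σ → ℂ) {m : ℕ} : ∀ {g : MvPolynomial σ ℂ},
    g.IsHomogeneous m → diffOp (linForm v ^ m) g = C (m.factorial * eval v g) := by
  induction m with
  | zero =>
    intro g hg
    rw [← totalDegree_zero_iff_isHomogeneous, totalDegree_eq_zero_iff_eq_C] at hg
    rw [hg]
    simp
  | succ m ih =>
    intro g hg
    have h1 : (diffOp (linForm v) g).IsHomogeneous m :=
      diffOp_isHomogeneous (linForm_isHomogeneous v) hg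
    rw [pow_succ, diffOp_mul_apply, ih h1, diffOp_linForm]
    congr 1
    have h2 := congrArg (eval v) hg.sum_X_mul_pderiv
    simp only [map_sum, map_mul, eval_X, nsmul_eq_mul, map_natCast] at h2
    simp only [map_sum, smul_eval, h2, Nat.factorial_succ, Nat.cast_mul]
    ring

end Apolarity

/-! ### The graded pieces of the apolar algebra -/

section Apolar

variable {σ : Type*} {f : MvPolynomial σ ℂ}

theorem act_injective : Function.Injective (act f) := by
  rw [injective_iff_map_eq_zero]
  intro x hx
  obtain ⟨α, rfl⟩ := Ideal.Quotient.mk_surjective x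
  exact Ideal.Quotient.eq_zero_iff_mem.mpr hx

theorem mem_gradedPiece_iff {k : ℕ} {x : A f} :
    x ∈ gradedPiece f k ↔ ∃ α : MvPolynomial σ ℂ, α.IsHomogeneous k ∧
      Ideal.Quotient.mk (Ann f) α = x := Iff.rfl

theorem act_isHomogeneous [Fintype σ] {d k : ℕ} (hf : f.IsHomogeneous d) {x : A f}
    (hx : x ∈ gradedPiece f k) : (act f x).IsHomogeneous (d - k) := by
  obtain ⟨α, hα, rfl⟩ := hx
  exact diffOp_isHomogeneous hα hf

theorem act_mk_mul (α : MvPolynomial σ ℂ) (x : A f) :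
    act f (Ideal.Quotient.mk (Ann f) α * x) = diffOp α (act f x) := by
  obtain ⟨β, rfl⟩ := Ideal.Quotient.mk_surjective x
  rw [← map_mul, act_mk, act_mk, diffOp_mul_apply]

theorem mem_span_basis {V κ : Type*} [AddCommGroup V] [Module ℂ V] {W : Submodule ℂ V}
    (b : Module.Basis κ ℂ W) {x : V} (hx : x ∈ W) :
    x ∈ Submodule.span ℂ (Set.range fun j => (b j : V)) := by
  have h := b.mem_span (⟨x, hx⟩ : W)
  have h' := Submodule.mem_map_of_mem (f := W.subtype) h
  rw [Submodule.map_span, ← Set.range_comp] at h'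
  exact h'

theorem gradedPiece_one : gradedPiece f 1 =
    Submodule.span ℂ (Set.range fun i => Ideal.Quotient.mk (Ann f) (X i)) := by
  rw [gradedPiece, homogeneousSubmodule_one_eq_span_X, Submodule.map_span, ← Set.range_comp]
  rfl

instance [Finite σ] (k : ℕ) : Module.Finite ℂ (gradedPiece f k) :=
  Module.Finite.iff_fg.mpr ((homogeneousSubmodule_fg σ ℂ k).map _)

end Apolar

/-! ### Comparison of Jacobians and Hessians -/

section Compare

variable {σ : Type*}

theorem jacRank_mono [Finite σ] {ι κ : Type*} {F : ι → MvPolynomial σ ℂ}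
    {G : κ → MvPolynomial σ ℂ} (h : ∀ j, F j ∈ Submodule.span ℂ (Set.range G)) :
    jacRank F ≤ jacRank G := by
  refine Submodule.finrank_mono (Submodule.span_le.mpr ?_)
  rintro _ ⟨j, rfl⟩
  have h1 := Submodule.mem_map_of_mem (f := grad.toLinearMap) (h j)
  rw [Submodule.map_span, ← Set.range_comp] at h1
  exact Submodule.span_subset_span ℂ (FractionRing (MvPolynomial σ ℂ)) _ h1

theorem genericRank_map_mul_le {ι κ τ : Type*} [Fintype κ] [Fintype τ] [Finite ι]
    (P : Matrix ι τ ℂ) (M : Matrix τ κ (MvPolynomial σ ℂ)) :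
    genericRank ((P.map C : Matrix ι τ (MvPolynomial σ ℂ)) * M) ≤ genericRank M := by
  rw [genericRank, Matrix.map_mul]
  exact Matrix.rank_mul_le_right _ _

variable {f : MvPolynomial σ ℂ} {ι κ : Type*}

/-- The basis a and the classes of the variables both span A_1, so each matrix is a constant matrix
times the other. -/
theorem genericRank_mixedHessian [Fintype σ] [Fintype ι] [Fintype κ] {k : ℕ}
    (a : Module.Basis ι ℂ (gradedPiece f 1)) (b : Module.Basis κ ℂ (gradedPiece f k)) :
    genericRank (mixedHessian f a b) = jacRank fun j => act f (b j : A f) := by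
  rw [← genericRank_jacobian]
  have hJ : ∀ l j, jacobian (fun j => act f (b j : A f)) l j =
      act f (Ideal.Quotient.mk (Ann f) (X l) * (b j : A f)) := fun l j => by
    rw [act_mk_mul, diffOp_X]; rfl
  apply le_antisymm
  · have h : ∀ i, ∃ c : σ → ℂ, ∑ l, c l • Ideal.Quotient.mk (Ann f) (X l) = (a i : A f) := by
      intro i
      rw [← Submodule.mem_span_range_iff_exists_fun, ← gradedPiece_one]
      exact (a i).2
    choose P hP using h
    have : mixedHessian f a b =
        ((Matrix.of P).map C : Matrix ι σ (MvPolynomial σ ℂ)) *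
          jacobian (fun j => act f (b j : A f)) := by
      ext1 i j
      rw [Matrix.mul_apply]
      simp only [hJ, mixedHessian, Matrix.of_apply, Matrix.map_apply, ← hP, Finset.sum_mul,
        map_sum, smul_mul_assoc, map_smul, smul_eq_C_mul]
    rw [this]
    exact genericRank_map_mul_le _ _
  · have h : ∀ l, ∃ c : ι → ℂ, ∑ i, c i • (a i : A f) = Ideal.Quotient.mk (Ann f) (X l) := by
      intro l
      rw [← Submodule.mem_span_range_iff_exists_fun]
      exact mem_span_basis a (mem_gradedPiece_iff.mpr ⟨X l, isHomogeneous_X ℂ l, rfl⟩)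
    choose P hP using h
    have : jacobian (fun j => act f (b j : A f)) =
        ((Matrix.of P).map C : Matrix σ ι (MvPolynomial σ ℂ)) *
          mixedHessian f a b := by
      ext1 l j
      rw [Matrix.mul_apply]
      simp only [hJ, mixedHessian, Matrix.of_apply, Matrix.map_apply, ← hP, Finset.sum_mul,
        map_sum, smul_mul_assoc, map_smul, smul_eq_C_mul]
    rw [this]
    exact genericRank_map_mul_le _ _

theorem mem_span_prod_X {k : ℕ} {β : MvPolynomial σ ℂ} (hβ : β.IsHomogeneous k) :
    β ∈ Submodule.span ℂ (Set.range fun s : Sym σ k =>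
      ((s : Multiset σ).map (X : σ → MvPolynomial σ ℂ)).prod) := by
  rw [β.as_sum]
  refine Submodule.sum_mem _ fun s hs => ?_
  rw [← mul_one (coeff s β), ← smul_eq_mul, ← smul_monomial]
  refine Submodule.smul_mem _ _ (Submodule.subset_span
    ⟨⟨Finsupp.toMultiset s, ?_⟩, ?_⟩)
  · rw [Finsupp.card_toMultiset]
    have := hβ (mem_support_iff.mp hs)
    rw [Finsupp.weight_apply] at this
    simpa [Finsupp.sum] using this
  · change ((Finsupp.toMultiset s).map X).prod = _
    rw [Finsupp.toMultiset_map, Finsupp.prod_toMultiset, Finsupp.prod_mapDomain_index, monomial_eq,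
      C_1, one_mul] <;> simp [pow_add]

theorem act_mem_span_polar {k : ℕ} {x : A f} (hx : x ∈ gradedPiece f k) :
    act f x ∈ Submodule.span ℂ (Set.range fun s : Sym σ k =>
      diffOp ((s : Multiset σ).map X).prod f) := by
  obtain ⟨β, hβ, rfl⟩ := hx
  have h1 := Submodule.mem_map_of_mem (f := diffOp.toLinearMap.flip f) (mem_span_prod_X hβ)
  rw [Submodule.map_span, ← Set.range_comp] at h1
  exact h1

theorem act_mem_span_relPolar {k : ℕ} (b : Module.Basis κ ℂ (gradedPiece f k)) {x : A f}
    (hx : x ∈ gradedPiece f k) :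
    act f x ∈ Submodule.span ℂ (Set.range fun j => act f (b j : A f)) := by
  have h1 := Submodule.mem_map_of_mem (f := act f) (mem_span_basis b hx)
  rw [Submodule.map_span, ← Set.range_comp] at h1
  exact h1

theorem prod_X_isHomogeneous {k : ℕ} (s : Sym σ k) :
    (((s : Multiset σ).map (X : σ → MvPolynomial σ ℂ)).prod).IsHomogeneous k := by
  have h : ∀ t : Multiset σ,
      ((t.map (X : σ → MvPolynomial σ ℂ)).prod).IsHomogeneous (Multiset.card t) := by
    intro t
    induction t using Multiset.induction_on with
    | empty => exact isHomogeneous_one _ _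
    | cons i t ih =>
      rw [Multiset.map_cons, Multiset.prod_cons, Multiset.card_cons, add_comm]
      exact (isHomogeneous_X ℂ i).mul ih
  have := h s
  rwa [Sym.card_coe] at this

end Compare

/-! ### Cones and linear annihilators -/

theorem zero_notMem_vars_of_pderiv_eq_zero {σ : Type*} {i : σ} {g : MvPolynomial σ ℂ}
    (h : pderiv i g = 0) : i ∉ g.vars := by
  classical
  rw [mem_vars_iff_mem_support]
  rintro ⟨s, hs, his⟩
  have hsi : s i ≠ 0 := Finsupp.mem_support_iff.mp his
  have h1 := congrArg (coeff (s - Finsupp.single i 1)) h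
  rw [coeff_pderiv, coeff_zero] at h1
  have h2 : s - Finsupp.single i 1 + Finsupp.single i 1 = s :=
    tsub_add_cancel_of_le (Finsupp.single_le_iff.mpr (Nat.one_le_iff_ne_zero.mpr hsi))
  rw [h2] at h1
  rcases mul_eq_zero.mp h1 with h3 | h3
  · exact mem_support_iff.mp hs h3
  · exact Nat.cast_add_one_ne_zero _ h3

section Cone

variable {n : ℕ} {f : MvPolynomial (Fin (n + 1)) ℂ}

/-- Complete v to a basis: in the new coordinates ∂/∂x_0 is the derivative along v. -/
theorem isCone_of_diffOp_linForm_eq_zero {v : Fin (n + 1) → ℂ} (hv : v ≠ 0)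
    (h : diffOp (linForm v) f = 0) : IsCone f := by
  obtain ⟨y, hy, hy0⟩ := exists_linearIndependent_zero_eq (K := ℂ) hv n (by simp)
  have hu : IsUnit (Matrix.of y).transpose := by
    rw [Matrix.isUnit_transpose, ← Matrix.linearIndependent_rows_iff_isUnit]
    exact hy
  obtain ⟨M, hM⟩ := hu
  refine ⟨M, zero_notMem_vars_of_pderiv_eq_zero ?_⟩
  have h1 : ∀ l, pderiv 0 (∑ j, C (M.1 l j) * X j : MvPolynomial (Fin (n + 1)) ℂ) = C (v l) := by
    intro l
    rw [map_sum, Finset.sum_eq_single 0]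
    · rw [pderiv_C_mul, pderiv_X_self, mul_one, hM, ← hy0]; rfl
    · intro b _ hb
      rw [pderiv_C_mul, pderiv_X_of_ne hb, mul_zero]
    · simp
  rw [diffOp_linForm] at h
  change pderiv 0 (aeval _ f) = 0
  rw [pderiv_aeval]
  simp only [h1]
  have h2 := congrArg (aeval fun l => (∑ j, C (M.1 l j) * X j : MvPolynomial (Fin (n + 1)) ℂ)) h
  rw [map_sum, map_zero] at h2
  rw [← h2]
  refine Finset.sum_congr rfl fun l _ => ?_
  rw [map_smul, smul_eq_C_mul, mul_comm]

theorem ne_zero_of_not_isCone (h : ¬ IsCone f) : f ≠ 0 := by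
  rintro rfl
  exact h ⟨1, by simp⟩

theorem finrank_gradedPiece_one (h : ¬ IsCone f) :
    Module.finrank ℂ (gradedPiece f 1) = n + 1 := by
  have hLI : LinearIndependent ℂ fun i : Fin (n + 1) => Ideal.Quotient.mk (Ann f) (X i) := by
    rw [Fintype.linearIndependent_iff]
    intro c hc
    by_contra! hne
    obtain ⟨i, hi⟩ := hne
    refine h (isCone_of_diffOp_linForm_eq_zero (v := c) (fun h0 => hi (congrFun h0 i)) ?_)
    have := congrArg (act f) hc
    rw [map_sum, map_zero] at this
    rw [diffOp_linForm, ← this]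
    refine Finset.sum_congr rfl fun l _ => ?_
    rw [map_smul, act_mk, diffOp_X]
  rw [gradedPiece_one, finrank_span_eq_card hLI, Fintype.card_fin]

end Cone

/-! ### Multiplication by powers of linear forms and the Hessian -/

section Multiplication

variable {σ : Type*} [Fintype σ] {f : MvPolynomial σ ℂ} {d k : ℕ}

/-- With x the class of α, L^(d-k-1) α (f) is a form of degree k, so it is zero iff every β of
degree k kills it. Commuting β past the power of L turns that into (αβ f)(v) = 0. -/
theorem mulPow_eq_zero_iff (hf : f.IsHomogeneous d) (hkd : 1 ≤ d - k) {κ : Type*}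
    (b : Module.Basis κ ℂ (gradedPiece f k)) (v : σ → ℂ) (L x : gradedPiece f 1)
    (hL : (L : A f) = Ideal.Quotient.mk (Ann f) (linForm v)) :
    mulPow f hkd L x = 0 ↔ ∀ j, eval v (act f ((x : A f) * (b j : A f))) = 0 := by
  obtain ⟨x, α, hα, rfl⟩ := x
  have hm : (d - k - 1).factorial ≠ 0 := Nat.factorial_ne_zero _
  have h0 : mulPow f hkd L ⟨_, α, hα, rfl⟩ = 0 ↔
      diffOp (linForm v ^ (d - k - 1)) (diffOp α f) = 0 := by
    rw [← diffOp_mul_apply, ← act_mk, map_eq_zero_iff _ act_injective, map_mul, map_pow, ← hL]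
    exact Subtype.ext_iff
  have h1 : ∀ β : MvPolynomial σ ℂ, β.IsHomogeneous k →
      diffOp β (diffOp (linForm v ^ (d - k - 1)) (diffOp α f)) =
        C ((d - k - 1).factorial * eval v (diffOp (α * β) f)) := by
    intro β hβ
    have h2 : (diffOp (α * β) f).IsHomogeneous (d - k - 1) := by
      have := diffOp_isHomogeneous (hα.mul hβ) hf
      rwa [add_comm, ← Nat.sub_sub] at this
    rw [← diffOp_linForm_pow v h2]
    simp only [← diffOp_mul_apply]
    congr 2
    ring
  have h3 : (diffOp (linForm v ^ (d - k - 1)) (diffOp α f)).IsHomogeneous k := by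
    have h4 := (linForm_isHomogeneous v).pow (d - k - 1)
    have := diffOp_isHomogeneous h4 (diffOp_isHomogeneous hα hf)
    rwa [show d - 1 - 1 * (d - k - 1) = k by omega] at this
  rw [h0]
  constructor
  · intro h j
    obtain ⟨β, hβ, hβj⟩ := (b j).2
    have h5 := h1 β hβ
    rw [h, map_zero, eq_comm, ← C_0, C_inj, mul_eq_zero, Nat.cast_eq_zero] at h5
    rw [← hβj]
    exact h5.resolve_left hm
  · intro h
    by_contra hne
    obtain ⟨β, hβ, hβne⟩ := exists_diffOp_ne_zero h3 hne le_rfl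
    apply hβne
    rw [h1 β hβ]
    have h6 : Ideal.Quotient.mk (Ann f) β ∈
        Submodule.span ℂ (Set.range fun j => (b j : A f)) :=
      mem_span_basis b ⟨β, hβ, rfl⟩
    -- The hypothesis on the basis extends linearly to all of A_k.
    have h7 : eval v (act f (Ideal.Quotient.mk (Ann f) α * Ideal.Quotient.mk (Ann f) β)) = 0 := by
      generalize Ideal.Quotient.mk (Ann f) β = y at h6
      induction h6 using Submodule.span_induction with
      | mem y hy =>
        obtain ⟨j, rfl⟩ := hy
        exact h j
      | zero => simp
      | add y z _ _ hy hz => rw [mul_add, map_add, map_add, hy, hz, add_zero]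
      | smul c y _ hy => rw [mul_smul_comm, map_smul, smul_eval, hy, mul_zero]
    rw [← map_mul, act_mk] at h7
    rw [h7, mul_zero, C_0]

theorem mulPow_injective_iff (hf : f.IsHomogeneous d) (hkd : 1 ≤ d - k) {ι κ : Type*} [Fintype ι]
    (a : Module.Basis ι ℂ (gradedPiece f 1))
    (b : Module.Basis κ ℂ (gradedPiece f k)) (v : σ → ℂ) (L : gradedPiece f 1)
    (hL : (L : A f) = Ideal.Quotient.mk (Ann f) (linForm v)) :
    Function.Injective (mulPow f hkd L) ↔
      LinearIndependent ℂ ((mixedHessian f a b).map (eval v)).row := by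
  have key : ∀ c : ι → ℂ, mulPow f hkd L (∑ i, c i • a i) = 0 ↔
      ∑ i, c i • ((mixedHessian f a b).map (eval v)).row i = 0 := by
    intro c
    rw [mulPow_eq_zero_iff hf hkd b v L _ hL, funext_iff]
    refine forall_congr' fun j => ?_
    rw [Finset.sum_apply]
    simp only [Submodule.coe_sum, Submodule.coe_smul, Finset.sum_mul, smul_mul_assoc, map_sum,
      map_smul, smul_eval, Pi.smul_apply, smul_eq_mul, Pi.zero_apply]
    rfl
  rw [injective_iff_map_eq_zero, Fintype.linearIndependent_iff]
  constructor
  · intro h c hc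
    have h1 := h _ ((key c).mpr hc)
    exact Fintype.linearIndependent_iff.mp a.linearIndependent c h1
  · intro h x hx
    rw [← a.sum_repr x] at hx ⊢
    have h1 := h _ ((key _).mp hx)
    simp only [h1, zero_smul, Finset.sum_const_zero]

/-- Surjectivity forces injectivity: if L^(d-k-1) x = 0 and the multiplication is onto, then A_(d-k)
x = 0, and apolarity gives x = 0. -/
theorem hasMaximalRank_mulPow_iff (hf : f.IsHomogeneous d) (hk : 0 < k) (hkd : 1 ≤ d - k)
    (L : gradedPiece f 1) : HasMaximalRank (mulPow f hkd L) ↔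
      Function.Injective (mulPow f hkd L) := by
  constructor
  · intro h
    rw [HasMaximalRank] at h
    rcases min_choice (Module.finrank ℂ (gradedPiece f 1))
      (Module.finrank ℂ (gradedPiece f (d - k))) with h1 | h1
    · rw [h1] at h
      have h2 := LinearMap.finrank_range_add_finrank_ker (mulPow f hkd L)
      rw [h, Nat.add_eq_left, Submodule.finrank_eq_zero] at h2
      exact LinearMap.ker_eq_bot.mp h2
    · rw [h1] at h
      have hsurj := LinearMap.range_eq_top.mp (Submodule.eq_top_of_finrank_eq h)
      rw [injective_iff_map_eq_zero]
      rintro ⟨x, hx⟩ hLx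
      have hLx' : (L : A f) ^ (d - k - 1) * x = 0 := congrArg Subtype.val hLx
      rw [Submodule.mk_eq_zero, ← map_eq_zero_iff _ (act_injective (f := f))]
      by_contra hne
      -- The degree bound d - k ≤ d - 1 is where k > 0 enters.
      obtain ⟨δ, hδ, hδne⟩ := exists_diffOp_ne_zero (k := d - k) (act_isHomogeneous hf hx) hne
        (by omega)
      apply hδne
      obtain ⟨y, hy⟩ := hsurj ⟨Ideal.Quotient.mk (Ann f) δ, δ, hδ, rfl⟩
      have hy' : (L : A f) ^ (d - k - 1) * y = Ideal.Quotient.mk (Ann f) δ :=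
        congrArg Subtype.val hy
      rw [← act_mk_mul, ← hy', mul_right_comm, hLx', zero_mul, map_zero]
  · intro h
    have h1 := LinearMap.finrank_range_of_inj h
    rw [HasMaximalRank, h1, eq_comm, min_eq_left_iff, ← h1]
    exact Submodule.finrank_le _

end Multiplication

end

end HigherPolar

/-! ### The main theorem -/

open HigherPolar in
theorem theorem5p2 {n d k : ℕ} (hk : 0 < k) (hkd : k < d)
    (f : MvPolynomial (Fin (n + 1)) ℂ) (hf : f.IsHomogeneous d) (hcone : ¬ HigherPolar.IsCone f)
    {ι κ : Type*} [Fintype ι] [Fintype κ]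
    (a : Module.Basis ι ℂ (HigherPolar.gradedPiece f 1))
    (b : Module.Basis κ ℂ (HigherPolar.gradedPiece f k)) :
    topologicalKrullDim (HigherPolar.relPolarImage f b)
        = topologicalKrullDim (HigherPolar.polarImage f k) ∧
      topologicalKrullDim (HigherPolar.relPolarImage f b) + 1
        = (HigherPolar.genericRank (HigherPolar.mixedHessian f a b) : WithBot ℕ∞) ∧
      List.TFAE
        [topologicalKrullDim (HigherPolar.relPolarImage f b) < (n : WithBot ℕ∞),
          HigherPolar.genericRank (HigherPolar.mixedHessian f a b) < n + 1,
          ∀ L : HigherPolar.gradedPiece f 1,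
            ¬ HigherPolar.HasMaximalRank
              (HigherPolar.mulPow f (Nat.sub_pos_of_lt hkd : 1 ≤ d - k) L)] := by
  have hm : d - k ≠ 0 := (Nat.sub_pos_of_lt hkd).ne'
  have hf0 := ne_zero_of_not_isCone hcone
  set F : κ → MvPolynomial (Fin (n + 1)) ℂ := fun j => act f (b j : A f) with hFdef
  set G : Sym (Fin (n + 1)) k → MvPolynomial (Fin (n + 1)) ℂ :=
    fun s => diffOp ((s : Multiset (Fin (n + 1))).map X).prod f with hGdef
  have hF : ∀ j, (F j).IsHomogeneous (d - k) := fun j => act_isHomogeneous hf (b j).2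
  have hG : ∀ s, (G s).IsHomogeneous (d - k) := fun s =>
    diffOp_isHomogeneous (prod_X_isHomogeneous s) hf
  have hFG : jacRank F = jacRank G :=
    le_antisymm (jacRank_mono fun j => act_mem_span_polar (b j).2)
      (jacRank_mono fun s => act_mem_span_relPolar b ⟨_, prod_X_isHomogeneous s, rfl⟩)
  -- An operator of degree k not killing f shows that neither polar family is identically zero.
  obtain ⟨β, hβ, hβf⟩ := exists_diffOp_ne_zero hf hf0 hkd.le
  have hF0 : F ≠ 0 := by
    intro h
    have h1 := act_mem_span_relPolar b (x := Ideal.Quotient.mk (Ann f) β) ⟨β, hβ, rfl⟩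
    rw [act_mk, ← hFdef, h] at h1
    rw [Submodule.span_eq_bot.mpr (by rintro _ ⟨_, rfl⟩; rfl), Submodule.mem_bot] at h1
    exact hβf h1
  have hG0 : G ≠ 0 := by
    intro h
    have h1 := act_mem_span_polar (x := Ideal.Quotient.mk (Ann f) β) ⟨β, hβ, rfl⟩
    rw [act_mk, ← hGdef, h] at h1
    rw [Submodule.span_eq_bot.mpr (by rintro _ ⟨_, rfl⟩; rfl), Submodule.mem_bot] at h1
    exact hβf h1
  have hdimF : topologicalKrullDim (relPolarImage f b) = (jacRank F - 1 : ℕ) :=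
    topologicalKrullDim_closure_ran hF hm hF0
  have hdimG : topologicalKrullDim (polarImage f k) = (jacRank G - 1 : ℕ) :=
    topologicalKrullDim_closure_ran hG hm hG0
  have hrank : genericRank (mixedHessian f a b) = jacRank F := genericRank_mixedHessian a b
  have hpos : 0 < jacRank F := jacRank_pos hF hm hF0
  have hcard : Fintype.card ι = n + 1 := by
    rw [← Module.finrank_eq_card_basis a, finrank_gradedPiece_one hcone]
  refine ⟨by rw [hdimF, hdimG, hFG], ?_, ?_⟩
  · rw [hdimF, hrank]
    exact_mod_cast congrArg (Nat.cast : ℕ → WithBot ℕ∞) (Nat.succ_pred hpos.ne')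
  tfae_have 1 ↔ 2 := by
    rw [hdimF, hrank]
    have : ((jacRank F - 1 : ℕ) : WithBot ℕ∞) < (n : ℕ) ↔ jacRank F - 1 < n := by
      exact_mod_cast Iff.rfl
    rw [this]
    -- Positivity of the rank matters for the truncated subtraction when n = 0.
    omega
  tfae_have 2 ↔ 3 := by
    rw [← not_iff_not, not_lt, not_forall]
    simp only [not_not, hasMaximalRank_mulPow_iff hf hk]
    constructor
    · intro h
      -- A point v where the Hessian attains its generic rank serves as coefficient vector of L.
      obtain ⟨v, -, hv⟩ := exists_genericRank_le_rank_map_eval (mixedHessian f a b)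
        (one_ne_zero (α := MvPolynomial (Fin (n + 1)) ℂ))
      refine ⟨⟨Ideal.Quotient.mk (Ann f) (linForm v), linForm v, linForm_isHomogeneous v, rfl⟩,
        (mulPow_injective_iff hf _ a b v _ rfl).mpr ?_⟩
      rw [linearIndependent_iff_card_le_finrank_span, hcard]
      refine (h.trans hv).trans (le_of_eq ?_)
      rw [Matrix.rank_eq_finrank_span_row]
      rfl
    · rintro ⟨⟨L, l, hl, hlL⟩, hL⟩
      obtain ⟨v, rfl⟩ := exists_eq_linForm hl
      have h1 := (mulPow_injective_iff hf _ a b v _ hlL.symm).mp hL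
      exact (hcard.symm.trans h1.rank_matrix.symm).le.trans (rank_map_eval_le_genericRank _ v)
  tfae_finish
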